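/- Let $\mathbb{F}_q$ be a finite field, let $C$ be a nonsingular projective curve over $\mathbb{F}_q$, let $\infty$ be a closed point of $C$, and let $A$ be the ring of functions on $C$ that are regular everywhere except possibly at $\infty$. Let $K\supseteq\mathbb{F}_q$ be a countable field with algebraic closure $K^{\mathrm{alg}}$ and let $K^{\mathrm{per}}\subseteq K^{\mathrm{alg}}$ be its perfect closure. *Valuations.* For a field $L$ let $M_L$ be the set of discrete valuations of $L$, normalized to have value group $\mathbb{Z}$. A good set of valuations on $L$ is a subset $U\subseteq M_L$ with a function $d:U\to\mathbb{R}_{>0}$ such that for every nonzero $x\in L$ one has $v(x)\neq 0$ for only finitely many $v\in U$, and $\sum_{v\in U}d(v)v(x)=0$. Its field of constants is $\{0\}\cup\{x\in L : v(x)=0\text{ for all }v\in U\}$. A valuation $v\in M_K$ is coherent if $\sum_{w\in M_L,\,w|v}e(w|v)f(w|v)=[L:K]$ for every finite extension $L\subseteq K^{\mathrm{alg}}$ of $K$. A good set $U$ on $K$ is coherent if every $v\in U$ is coherent and, for every finite extension $L\subseteq K^{\mathrm{alg}}$ of $K$, the set $U_L$ of all $w\in M_L$ lying over some $v\in U$,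 with the degrees $d(w)=f(w|v)d(v)/[L:K]$, is a good set of valuations on $L$. *Drinfeld modules.* Let $\tau(x)=x^q$ and let $K\{\tau\}$ be the ring of polynomials in $\tau$ with coefficients in $K$, multiplied by composition (so $\tau a=a^q\tau$). Let $i:A\to K$ be a ring homomorphism. A Drinfeld module is a ring homomorphism $\phi:A\to K\{\tau\}$, $a\mapsto\phi_a$, such that the coefficient of $\tau^0$ in $\phi_a$ is $i(a)$ for all $a\in A$, and $\phi_a\neq i(a)\tau^0$ for some $a\in A$. For an extension $L$ of $K$, $\phi(L)$ is the additive group of $L$ with the $A$-module structure given by $\phi$. For $\gamma\in K^{\mathrm{alg}}\setminus\{0\}$ let $\phi^{(\gamma)}_a=\gamma^{-1}\phi_a\gamma$. The field of definition of $\phi^{(\gamma)}$ is the smallest subfield of $K^{\mathrm{alg}}$ containing all coefficients of all $\phi^{(\gamma)}_a$, $a\in A$. The relative modular transcendence degree of $\phi$ over a subfield $K_0$ of $K$ is the minimum, over all $\gamma\in K^{\mathrm{alg}}\setminus\{0\}$, of the transcendence degree over $K_0$ of the compositum of $K_0$ and the field of definition of $\phi^{(\gamma)}$. **Theorem.** Let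 $U$ be a coherent good set of valuations on $K$ with field of constants $K_0$, and let $\phi:A\to K\{\tau\}$ be a Drinfeld module of positive relative modular transcendence degree over $K_0$. Then the $A$-module $\phi(K^{\mathrm{per}})$ is the direct sum of a finite torsion submodule and a free submodule of rank $\aleph_0$. -/

import Mathlib

open scoped WithZero

noncomputable section

/-! ### The ring `A` attached to a curve over a finite field and a closed point -/

/-- `F` is the function field of a (nonsingular projective) curve over the field `k`: a finitely
generated field extension of transcendence degree one. -/
def IsCurveFunctionField (k F : Type*) [Field k] [Field F] [Algebra k F] : Prop :=
  (⊤ : IntermediateField k F).FG ∧ Algebra.trdeg k F = 1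

/-- The ring of functions that are regular away from `P`. If `F` is the function field of a
nonsingular projective curve `C` over a finite field, then the closed points `x` of `C` correspond
to the valuation subrings `≠ ⊤` of `F` through `x ↦ 𝒪_{C,x}` (every valuation ring of `F` contains
the finite field), and `f` is regular at `x` if and only if it lies in `𝒪_{C,x}`. -/
def regularAwayFrom {F : Type*} [Field F] (P : ValuationSubring F) : Subring F :=
  ⨅ (V : ValuationSubring F) (_ : V ≠ ⊤ ∧ V ≠ P), V.toSubring

/-! ### The twisted polynomial ring `K{τ}` -/

/-- The action of `ℕ` on a commutative `Fq`-algebra `K` through powers of `τ : x ↦ x ^ q`. -/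
@[reducible] def frobeniusAction (Fq K : Type*) [Field Fq] [Fintype Fq] [CommRing K]
    [Algebra Fq K] : MulSemiringAction (Multiplicative ℕ) K :=
  MulSemiringAction.compHom K
    (powersHom (K →+* K) (FiniteField.frobeniusAlgHom Fq K : K →+* K))

/-- `K{τ}`: polynomials `∑ aₙ τⁿ` with coefficients in `K` and `τ a = a ^ q τ`, `q = #Fq`. -/
def TwistedPoly (Fq K : Type*) [Field Fq] [Fintype Fq] [CommRing K] [Algebra Fq K] : Type _ :=
  SkewPolynomial K

namespace TwistedPoly

section

variable {Fq : Type*} [Field Fq] [Fintype Fq] {K : Type*} [CommRing K] [Algebra Fq K]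

instance instRing : Ring (TwistedPoly Fq K) :=
  letI := frobeniusAction Fq K
  inferInstanceAs (Ring (SkewPolynomial K))

/-- The coefficient of `τ ^ n`. -/
def coeff (p : TwistedPoly Fq K) (n : ℕ) : K := SkewPolynomial.coeff p n

variable (Fq) in
/-- The constants `a = a τ⁰`. -/
def C : K →+* TwistedPoly Fq K :=
  letI := frobeniusAction Fq K
  (SkewPolynomial.CRingHom : K →+* SkewPolynomial K)

variable (Fq K) in
/-- The operator `τ` as an element of `K{τ}`. -/
def tau : TwistedPoly Fq K := (SkewPolynomial.X : SkewPolynomial K)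

theorem frobeniusAction_smul (m : Multiplicative ℕ) (x : K) :
    letI := frobeniusAction Fq K
    m • x = x ^ (Fintype.card Fq ^ m.toAdd) := by
  change ((FiniteField.frobeniusAlgHom Fq K : K →+* K) ^ m.toAdd) x = _
  rw [RingHom.coe_pow]
  change (fun y : K => y ^ Fintype.card Fq)^[m.toAdd] x = _
  rw [pow_iterate]

theorem tau_pow_mul_C (n : ℕ) (x : K) :
    tau Fq K ^ n * C Fq x = C Fq (x ^ (Fintype.card Fq ^ n)) * tau Fq K ^ n := by
  let := frobeniusAction Fq K
  have h1 : ∀ y : K, tau Fq K * C Fq y = C Fq (y ^ Fintype.card Fq) * tau Fq K := by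
    intro y
    change (SkewPolynomial.monomial 1 1 : SkewPolynomial K) * SkewPolynomial.C y =
      SkewPolynomial.C (y ^ Fintype.card Fq) * (SkewPolynomial.monomial 1 1 : SkewPolynomial K)
    have h2 : (Multiplicative.ofAdd 1 : Multiplicative ℕ) • y = y ^ Fintype.card Fq := by
      rw [frobeniusAction_smul (Fq := Fq)]
      simp
    rw [SkewPolynomial.monomial_mul_C, SkewPolynomial.C_mul_monomial,
      SkewPolynomial.φ_iterate_apply, h2]
    simp
  induction n generalizing x with
  | zero => simp
  | succ n ih =>
    rw [pow_succ, mul_assoc, h1, ← mul_assoc, ih, mul_assoc, ← pow_mul, ← pow_succ']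

variable (Fq K) in
/-- Extension of coefficients `K{τ} → L{τ}`. -/
def mapAlg (L : Type*) [CommRing L] [Algebra Fq L] [Algebra K L] :
    TwistedPoly Fq K →+* TwistedPoly Fq L :=
  letI := frobeniusAction Fq K
  (SkewMonoidAlgebra.liftNCRingHom ((C Fq (K := L)).comp (algebraMap K L))
    (powersHom (TwistedPoly Fq L) (tau Fq L)) (by
      intro x y
      rw [frobeniusAction_smul (Fq := Fq), powersHom_apply, RingHom.comp_apply,
        RingHom.comp_apply, tau_pow_mul_C, map_pow]) :
    SkewPolynomial K →+* TwistedPoly Fq L)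

variable (Fq) in
/-- The additive map `τ : x ↦ x ^ q`. -/
def frobeniusEnd (L : Type*) [CommRing L] [Algebra Fq L] : AddMonoid.End L :=
  ((FiniteField.frobeniusAlgHom Fq L : L →+* L) : L →+ L)

theorem frobeniusEnd_pow_apply {L : Type*} [CommRing L] [Algebra Fq L] (n : ℕ) (z : L) :
    (frobeniusEnd Fq L ^ n) z = z ^ (Fintype.card Fq ^ n) := by
  induction n generalizing z with
  | zero => simp
  | succ n ih =>
    rw [pow_succ]
    change (frobeniusEnd Fq L ^ n) (z ^ Fintype.card Fq) = _
    rw [ih, ← pow_mul, ← pow_succ']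

variable (Fq K) in
/-- The action of `K{τ}` on a commutative `K`-algebra `L`: `∑ aₙ τⁿ` sends `x` to
`∑ aₙ x ^ (q ^ n)`. -/
def evalHom (L : Type*) [CommRing L] [Algebra Fq L] [Algebra K L] :
    TwistedPoly Fq K →+* AddMonoid.End L :=
  letI := frobeniusAction Fq K
  (SkewMonoidAlgebra.liftNCRingHom (Module.toAddMonoidEnd K L)
    (powersHom (AddMonoid.End L) (frobeniusEnd Fq L)) (by
      intro x y
      ext z
      change (y • x) • (frobeniusEnd Fq L ^ y.toAdd) z =
        (frobeniusEnd Fq L ^ y.toAdd) (x • z)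
      rw [frobeniusEnd_pow_apply, frobeniusEnd_pow_apply, frobeniusAction_smul (Fq := Fq),
        Algebra.smul_def, Algebra.smul_def, mul_pow, map_pow]) :
    SkewPolynomial K →+* AddMonoid.End L)

/-- The smallest subfield of `M` that contains all coefficients of all `ψ a`, `a ∈ A`. -/
def fieldOfDefinition {M A : Type*} [Field M] [Algebra Fq M] [Semiring A]
    (ψ : A →+* TwistedPoly Fq M) : Subfield M :=
  Subfield.closure {x | ∃ a n, (ψ a).coeff n = x}

end

end TwistedPoly

/-! ### Drinfeld modules -/

/-- A Drinfeld module `φ : A → K{τ}` over `i : A → K`: a ring homomorphism such that the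
coefficient of `τ⁰` in `φ a` is `i a` for all `a`, and `φ a ≠ i(a) τ⁰` for some `a`. -/
structure DrinfeldModule (Fq : Type*) {A K : Type*} [Field Fq] [Fintype Fq] [CommRing A]
    [Field K] [Algebra Fq K] (i : A →+* K) where
  /-- The underlying ring homomorphism `a ↦ φ a`. -/
  toRingHom : A →+* TwistedPoly Fq K
  coeff_zero : ∀ a, (toRingHom a).coeff 0 = i a
  exists_ne_const : ∃ a, toRingHom a ≠ TwistedPoly.C Fq (i a)

namespace DrinfeldModule

section

variable {Fq A K : Type*} [Field Fq] [Fintype Fq] [CommRing A] [Field K] [Algebra Fq K]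
  {i : A →+* K}

/-- `φ(L)`: the additive group of the extension `L` of `K`, with the action of `A` given
by `φ`. -/
def Points (_φ : DrinfeldModule Fq i) (L : Type*) : Type _ := L

instance (φ : DrinfeldModule Fq i) (L : Type*) [Field L] : AddCommGroup (φ.Points L) :=
  inferInstanceAs (AddCommGroup L)

instance (φ : DrinfeldModule Fq i) (L : Type*) [Field L] [Algebra Fq L] [Algebra K L] :
    Module A (φ.Points L) :=
  letI : Module (AddMonoid.End L) (φ.Points L) := inferInstanceAs (Module (AddMonoid.End L) L)
  Module.compHom (φ.Points L) ((TwistedPoly.evalHom Fq K L).comp φ.toRingHom)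

/-- The conjugate `φ^(γ) : a ↦ γ⁻¹ φ_a γ` for a nonzero element `γ` of an extension `L` of `K`. -/
def conj (φ : DrinfeldModule Fq i) {L : Type*} [Field L] [Algebra Fq L] [Algebra K L] (γ : Lˣ) :
    A →+* TwistedPoly Fq L where
  toFun a := TwistedPoly.C Fq (↑γ⁻¹ : L) * TwistedPoly.mapAlg Fq K L (φ.toRingHom a) *
    TwistedPoly.C Fq (γ : L)
  map_one' := by simp [← map_mul]
  map_zero' := by simp
  map_add' a b := by simp [mul_add, add_mul]
  map_mul' a b := by
    have h : TwistedPoly.C Fq (γ : L) * TwistedPoly.C Fq (↑γ⁻¹ : L) = 1 := by simp [← map_mul]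
    simp only [map_mul, mul_assoc]
    rw [← mul_assoc (TwistedPoly.C Fq (γ : L)), h, one_mul]

/-- The relative modular transcendence degree of `φ` over a subfield `K₀` of `K`: the minimum over
the nonzero `γ` in the algebraic closure of `K` of the transcendence degree over `K₀` of the
compositum of `K₀` and the field of definition of `φ^(γ)`. -/
def relModularTrdeg (φ : DrinfeldModule Fq i) (K₀ : Subfield K) : Cardinal :=
  ⨅ γ : (AlgebraicClosure K)ˣ, Algebra.trdeg K₀
    (IntermediateField.adjoin K₀
      (TwistedPoly.fieldOfDefinition (φ.conj γ) : Set (AlgebraicClosure K)))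

end

end DrinfeldModule

/-! ### Discrete valuations and good sets of valuations -/

/-- The set `M_K` of discrete valuations of `K`, normalized to have value group `ℤ`. -/
structure DiscreteVal (K : Type*) [Field K] where
  /-- The valuation, written multiplicatively. -/
  val : Valuation K ℤᵐ⁰
  surjective : Function.Surjective val

namespace DiscreteVal

section

variable {K L : Type*} [Field K] [Field L] [Algebra K L]

/-- The additive value `v(x) ∈ ℤ` of a nonzero element `x`. -/
def ord (v : DiscreteVal K) (x : K) : ℤ := -WithZero.log (v.1 x)

/-- `w` lies over `v`: the restriction of `w` to `K` is equivalent to `v`. -/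
def LiesOver (w : DiscreteVal L) (v : DiscreteVal K) : Prop := v.1.HasExtension w.1

variable (K) in
/-- The index of the value group `w(Kˣ)` in the value group `w(Lˣ) = ℤ`; this is the ramification
index `e(w|v)` if `w` lies over the valuation `v` of `K`. -/
def ramificationIndex (w : DiscreteVal L) : ℕ :=
  (Units.map ((w.1 : L →* ℤᵐ⁰).comp (algebraMap K L : K →* L))).range.index

/-- The relative degree `f(w|v)`: the degree of the extension of residue fields. -/
def residueDegree (v : DiscreteVal K) (w : DiscreteVal L) (h : w.LiesOver v) : ℕ :=
  haveI : v.1.HasExtension w.1 := h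
  Module.finrank (IsLocalRing.ResidueField v.1.valuationSubring)
    (IsLocalRing.ResidueField w.1.valuationSubring)

/-- `v` is defectless in every finite extension `L` of `K` inside the algebraic closure of `K`:
`∑ e(w|v) f(w|v) = [L : K]`, where `w` runs over the (finitely many) valuations of `L`
over `v`. -/
def IsCoherent (v : DiscreteVal K) : Prop :=
  ∀ L : IntermediateField K (AlgebraicClosure K), FiniteDimensional K L →
    ∑ᶠ w : {w : DiscreteVal L // w.LiesOver v},
      w.1.ramificationIndex K * residueDegree v w.1 w.2 = Module.finrank K L

end

end DiscreteVal

/-- A good set `U` of valuations of `K` with degrees `d`. -/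
structure IsGoodSet {K : Type*} [Field K] (U : Set (DiscreteVal K)) (d : U → ℝ) : Prop where
  pos : ∀ v, 0 < d v
  finite : ∀ x : K, x ≠ 0 → {v : U | v.1.ord x ≠ 0}.Finite
  sum_formula : ∀ x : K, x ≠ 0 → ∑ᶠ v : U, d v * (v.1.ord x : ℝ) = 0

section

variable {K : Type*} [Field K]

/-- The set of valuations of an extension `L` of `K` that lie over a valuation in `U`. -/
def extendedSet (U : Set (DiscreteVal K)) (L : Type*) [Field L] [Algebra K L] :
    Set (DiscreteVal L) :=
  {w | ∃ v : U, w.LiesOver v.1}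

/-- The degree `d(w) = f(w|v) d(v) / [L : K]` of a valuation `w` of `L` over `v ∈ U`
(`v` is determined by `w`). -/
def extendedDegree {U : Set (DiscreteVal K)} (d : U → ℝ) (L : Type*) [Field L] [Algebra K L]
    (w : extendedSet U L) : ℝ :=
  DiscreteVal.residueDegree w.2.choose.1 w.1 w.2.choose_spec * d w.2.choose / Module.finrank K L

/-- A coherent good set of valuations of `K`. -/
structure IsCoherentGoodSet (U : Set (DiscreteVal K)) (d : U → ℝ) : Prop where
  isGoodSet : IsGoodSet U d
  isGoodSet_extended : ∀ L : IntermediateField K (AlgebraicClosure K), FiniteDimensional K L →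
    IsGoodSet (extendedSet U L) (extendedDegree d L)
  isCoherent : ∀ v ∈ U, v.IsCoherent

theorem DiscreteVal.ord_mul (v : DiscreteVal K) {x y : K} (hx : x ≠ 0) (hy : y ≠ 0) :
    v.ord (x * y) = v.ord x + v.ord y := by
  have hx' : v.1 x ≠ 0 := (Valuation.ne_zero_iff _).2 hx
  have hy' : v.1 y ≠ 0 := (Valuation.ne_zero_iff _).2 hy
  simp only [DiscreteVal.ord, map_mul, WithZero.log_mul hx' hy']
  ring

theorem DiscreteVal.ord_nonneg_iff (v : DiscreteVal K) {x : K} (hx : x ≠ 0) :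
    0 ≤ v.ord x ↔ v.1 x ≤ 1 := by
  have hx' : v.1 x ≠ 0 := (Valuation.ne_zero_iff _).2 hx
  rw [DiscreteVal.ord, neg_nonneg, ← WithZero.log_one, WithZero.log_le_log hx' one_ne_zero]

/-- By the sum formula, an element that is integral at all `v ∈ U` is a constant. -/
theorem IsGoodSet.ord_eq_zero {U : Set (DiscreteVal K)} {d : U → ℝ} (h : IsGoodSet U d) {x : K}
    (hx : x ≠ 0) (hint : ∀ v ∈ U, 0 ≤ v.ord x) : ∀ v ∈ U, v.ord x = 0 := by
  have hnn : ∀ v : U, 0 ≤ d v * (v.1.ord x : ℝ) := fun v =>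
    mul_nonneg (h.pos v).le (by exact_mod_cast hint v.1 v.2)
  have hfin : (Function.support fun v : U => d v * (v.1.ord x : ℝ)).Finite :=
    (h.finite x hx).subset fun v hv => by
      simp only [Function.mem_support] at hv
      intro h0
      exact hv (by simp [h0])
  intro v hv
  have h1 := h.sum_formula x hx
  have h2 := single_le_finsum (⟨v, hv⟩ : U) hfin hnn
  have h3 : d ⟨v, hv⟩ * (v.ord x : ℝ) = 0 := le_antisymm (h2.trans h1.le) (hnn ⟨v, hv⟩)
  have h4 := (mul_eq_zero.1 h3).resolve_left (h.pos _).ne'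
  exact_mod_cast h4

/-- The field of constants `{0} ∪ {x | v(x) = 0 for all v ∈ U}` of a good set of valuations. -/
def IsGoodSet.constants {U : Set (DiscreteVal K)} {d : U → ℝ} (h : IsGoodSet U d) :
    Subfield K where
  carrier := {x | x = 0 ∨ ∀ v ∈ U, v.ord x = 0}
  zero_mem' := Or.inl rfl
  one_mem' := Or.inr fun v _ => by simp [DiscreteVal.ord]
  mul_mem' := by
    rintro x y (rfl | hx) (rfl | hy)
    · simp
    · simp
    · simp
    · by_cases hx0 : x = 0
      · simp [hx0]
      by_cases hy0 : y = 0
      · simp [hy0]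
      exact Or.inr fun v hv => by rw [v.ord_mul hx0 hy0, hx v hv, hy v hv, add_zero]
  add_mem' := by
    have key : ∀ x : K, (x = 0 ∨ ∀ v ∈ U, v.ord x = 0) → ∀ v ∈ U, v.1 x ≤ 1 := by
      rintro x (rfl | hx) v hv
      · simp
      · by_cases hx0 : x = 0
        · simp [hx0]
        exact (v.ord_nonneg_iff hx0).1 (hx v hv).ge
    intro x y hx hy
    by_cases h0 : x + y = 0
    · exact Or.inl h0
    · exact Or.inr (h.ord_eq_zero h0 fun v hv => (v.ord_nonneg_iff h0).2
        ((v.1.map_add x y).trans (max_le (key x hx v hv) (key y hy v hv))))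
  neg_mem' := by
    rintro x (rfl | hx)
    · exact Or.inl neg_zero
    · exact Or.inr fun v hv => by
        have := hx v hv
        rwa [DiscreteVal.ord, Valuation.map_neg]
  inv_mem' := by
    rintro x (rfl | hx)
    · exact Or.inl inv_zero
    · exact Or.inr fun v hv => by
        have := hx v hv
        simp only [DiscreteVal.ord] at this
        simp only [DiscreteVal.ord, map_inv₀, WithZero.log_inv]
        omega

end

end

/-!
Let `p` be the characteristic, let `t ∈ A` have a nonconstant image `φ_t = ∑ aₙ τⁿ`, of degree `m`
in `τ`. Let `M` be the module of points over the perfect closure `E` of `K`,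
and let `R = 𝔽_p[X]` act on it through `X ↦ t`.

*Bad reduction.* If all the invariants `aₙ ^ (q ^ m - 1) / aₘ ^ (q ^ n - 1)` were constants, then
a conjugate of `φ_t` would be monic with coefficients algebraic over `K₀`, and so would be the
coefficients of all of the conjugate of `φ`, since they commute with it
(`DrinfeldModule.exists_invariant_notMem`). Hence some invariant has a pole `v ∈ U`. The
valuations in `U` extend uniquely to `E`, with the product formula, and at `v` the additive
polynomial `f` of `φ_t` has a term that exceeds the leading one on the circle of radius `θ_v` on
which the latter has size `θ_v`.

*Heights.* Let `h(x) = ∑ d(v) log⁺ (|x|_v / θ_v)`. At a bad place Lagrange interpolation shows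
that the points whose orbit under `f` does not escape lie in finitely many discs of radius smaller
than `θ_v` (`IsNonarchimedean.exists_isFinitelyCovered_iterate`). The difference of two points of
small canonical height that lie in the same discs at all bad places has small height, but it is
close to `0` at the bad places, against the product formula. So only finitely many points have
small canonical height (`ProductFormula.exists_finite_canonicalHeight_le`), even though `E` is not
finitely generated over `K`. It follows as in the theorem of Poonen on tame modules that the
`R`-torsion of `M` is finite and that the saturation of a finitely generated `R`-submodule is
finitely generated (`IsModuleHeight.finite_torsion`, `IsModuleHeight.fg_saturation`). Such a
saturation is not all of `M`, because finitely many points lie in `K ^ (1 / p ^ l)` for some `l`,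
and a uniformizer of a valuation of `K` has no root of order `p ^ (l + 1)` there.

*From `R` to `A`.* The function field has finite degree over `𝔽_p(t)`, so `A` has finite rank over
`R`. As `A x ≅ A` for a nontorsion point `x`, and `A x` lies in the saturation of a finitely
generated `R`-module, `A` is finite over `R`. As an intersection of valuation rings it is
integrally closed, hence a Dedekind domain, and the finiteness properties of `M` pass from `R` to
`A` (`Submodule.exists_isCompl_finite_free`).

*Structure.* For a Dedekind domain these properties make `M` the direct sum of its torsion and
countably many finitely generated projective modules, which can be taken of rank at least two.
Such a module has a free quotient of rank one, and an Eilenberg swindle shows that the sum is free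
(`Submodule.exists_isCompl_torsion`).
-/

open scoped WithZero

noncomputable section

/-! ### Countable modules over Dedekind domains -/

/-- The saturation of a submodule `N`: all `x` with `b • x ∈ N` for some nonzero `b`. -/
def Submodule.saturation {R M : Type*} [CommRing R] [IsDomain R] [AddCommGroup M] [Module R M]
    (N : Submodule R M) : Submodule R M :=
  (Submodule.torsion R (M ⧸ N)).comap N.mkQ

namespace Submodule

variable {R M : Type*} [CommRing R] [IsDomain R] [AddCommGroup M] [Module R M]

theorem mem_saturation {N : Submodule R M} {x : M} :
    x ∈ N.saturation ↔ ∃ b : R, b ≠ 0 ∧ b • x ∈ N := by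
  rw [saturation, mem_comap, mem_torsion_iff]
  constructor
  · rintro ⟨b, hb⟩
    refine ⟨b, nonZeroDivisors.ne_zero b.2, ?_⟩
    rwa [← Quotient.mk_eq_zero, Quotient.mk_smul]
  · rintro ⟨b, hb, h⟩
    refine ⟨⟨b, mem_nonZeroDivisors_of_ne_zero hb⟩, ?_⟩
    rwa [← Quotient.mk_eq_zero, Quotient.mk_smul] at h

theorem le_saturation (N : Submodule R M) : N ≤ N.saturation := fun x hx =>
  mem_saturation.2 ⟨1, one_ne_zero, by simpa using hx⟩

theorem mem_of_smul_mem_saturation {N : Submodule R M} {b : R} (hb : b ≠ 0) {x : M}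
    (h : b • x ∈ N.saturation) : x ∈ N.saturation := by
  obtain ⟨c, hc, h⟩ := mem_saturation.1 h
  exact mem_saturation.2 ⟨c * b, mul_ne_zero hc hb, by rwa [mul_smul]⟩

theorem saturation_bot : (⊥ : Submodule R M).saturation = torsion R M := by
  ext x
  rw [mem_saturation, mem_torsion_iff]
  constructor
  · rintro ⟨b, hb, h⟩
    exact ⟨⟨b, mem_nonZeroDivisors_of_ne_zero hb⟩, (mem_bot R).1 h⟩
  · rintro ⟨b, h⟩
    exact ⟨b, nonZeroDivisors.ne_zero b.2, (mem_bot R).2 h⟩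

end Submodule

variable {A : Type*} [CommRing A] [IsDedekindDomain A]

/-- Some homomorphic image of `J` in `A` is prime to `I`, since the class of `J` contains
ideals prime to `I`. -/
theorem IsDedekindDomain.exists_linearMap_sup_range_eq_top {I J : Ideal A} (hI : I ≠ ⊥)
    (hJ : J ≠ ⊥) : ∃ f : J →ₗ[A] A, I ⊔ LinearMap.range f = ⊤ := by
  obtain ⟨b, hbJ, hb⟩ := Submodule.exists_mem_ne_zero_of_ne_bot hJ
  obtain ⟨J', hJ'⟩ := Ideal.dvd_span_singleton.2 hbJ
  have hJ'0 : J' ≠ ⊥ := by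
    rintro rfl
    simp [hb] at hJ'
  obtain ⟨a, ha⟩ := IsDedekindDomain.exists_sup_span_eq (I := I * J') (J := J')
    Ideal.mul_le_right (mul_ne_zero hI hJ'0)
  have haJ' : a ∈ J' := by
    rw [← ha]
    exact Ideal.mem_sup_right (Ideal.mem_span_singleton_self a)
  have hdiv : ∀ j : J, ∃ c, b * c = a * j := fun j => by
    have : a * (j : A) ∈ Ideal.span {b} := by
      rw [hJ', mul_comm a]
      exact Ideal.mul_mem_mul j.2 haJ'
    obtain ⟨c, hc⟩ := Ideal.mem_span_singleton.1 this
    exact ⟨c, hc.symm⟩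
  choose f hf using hdiv
  refine ⟨⟨⟨f, fun x y => mul_left_cancel₀ hb ?_⟩, fun c x => mul_left_cancel₀ hb ?_⟩, ?_⟩
  · rw [mul_add, hf, hf, hf]
    simp [mul_add]
  · rw [hf]
    simp only [SetLike.val_smul, smul_eq_mul, RingHom.id_apply]
    rw [mul_left_comm, ← hf]
    ring
  · rw [eq_top_iff, ← Ideal.span_singleton_mul_right_mono hb, Ideal.mul_top]
    calc Ideal.span {b} = J * J' := hJ'
      _ = I * (J * J') ⊔ J * Ideal.span {a} := by
        conv_lhs => rw [← ha, Ideal.mul_sup]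
        rw [mul_left_comm]
      _ ≤ Ideal.span {b} * (I ⊔ LinearMap.range _) := by
        rw [Ideal.mul_sup, ← hJ', mul_comm I]
        refine sup_le_sup_left (Ideal.mul_le.2 fun j hj s hs => ?_) _
        obtain ⟨c, rfl⟩ := Ideal.mem_span_singleton.1 hs
        have : j * (a * c) = b * (c * f ⟨j, hj⟩) := by
          rw [mul_left_comm b, hf]
          ring
        rw [this]
        exact Ideal.mul_mem_mul (Ideal.mem_span_singleton_self b)
          (Ideal.mul_mem_left _ _ ⟨⟨j, hj⟩, rfl⟩)

variable {B : Type*} [AddCommGroup B] [Module A B]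

instance Module.Projective.of_finite_of_isTorsionFree [Module.Finite A B]
    [Module.IsTorsionFree A B] : Module.Projective A B :=
  have : Module.FinitePresentation A B := Module.finitePresentation_of_finite A B
  Module.Flat.projective_of_finitePresentation

/-- A finitely generated torsion-free module of rank at least two over a Dedekind domain has a
free quotient of rank one: it surjects onto `I ⊕ J` for two nonzero ideals `I`, `J`, and a multiple
of `J` is prime to `I`. -/
theorem IsDedekindDomain.exists_linearMap_surjective [Module.Finite A B]
    [Module.IsTorsionFree A B] {x y : B} (hxy : LinearIndependent A ![x, y]) :
    ∃ f : B →ₗ[A] A, Function.Surjective f := by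
  have hx : x ≠ 0 := hxy.ne_zero 0
  obtain ⟨f, hf⟩ : ∃ f : B →ₗ[A] A, f x ≠ 0 := by
    by_contra! h
    exact hx ((Module.forall_dual_apply_eq_zero_iff A x).1 h)
  set z := f x • y - f y • x with hz
  have hfz : f z = 0 := by simp [hz, mul_comm]
  have hz0 : z ≠ 0 := fun h => by
    have := LinearIndependent.pair_iff.1 hxy (-f y) (f x) (by rw [← h, hz, neg_smul]; abel)
    exact hf this.2
  obtain ⟨g, hg⟩ : ∃ g : B →ₗ[A] A, g z ≠ 0 := by
    by_contra! h
    exact hz0 ((Module.forall_dual_apply_eq_zero_iff A z).1 h)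
  obtain ⟨s, hs⟩ := f.rangeRestrict.exists_rightInverse_of_surjective f.range_rangeRestrict
  have hs' : ∀ i, f (s i) = i := fun i => congrArg Subtype.val (LinearMap.congr_fun hs i)
  have hfk : ∀ b, f (b - s (f.rangeRestrict b)) = 0 := fun b => by
    rw [map_sub, hs']
    simp
  let J : Ideal A := (LinearMap.ker f).map g
  obtain ⟨l, hl⟩ := IsDedekindDomain.exists_linearMap_sup_range_eq_top
    (I := LinearMap.range f) (J := J)
    (fun h => hf (by simpa [h] using LinearMap.mem_range_self f x))
    (fun h => hg (by
      have : g z ∈ J := Submodule.mem_map_of_mem hfz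
      simpa [h] using this))
  let π : B →ₗ[A] J := (g ∘ₗ (LinearMap.id - s ∘ₗ f.rangeRestrict)).codRestrict J
    fun b => Submodule.mem_map_of_mem (hfk b)
  refine ⟨f + l ∘ₗ π, LinearMap.range_eq_top.1 ?_⟩
  rw [eq_top_iff, ← hl, sup_le_iff]
  have hker : ∀ b, f b = 0 → (f + l ∘ₗ π) b = l (π b) := fun b hb => by simp [hb]
  have hrange : LinearMap.range l ≤ LinearMap.range (f + l ∘ₗ π) := by
    rintro _ ⟨⟨_, b, hb, rfl⟩, rfl⟩
    refine ⟨b, (hker b hb).trans (congrArg l (Subtype.ext ?_))⟩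
    have : f.rangeRestrict b = 0 := Subtype.ext hb
    simp [π, this]
  refine ⟨?_, hrange⟩
  rintro _ ⟨b, rfl⟩
  have h1 : f b = (f + l ∘ₗ π) b - l (π b) := by simp
  rw [h1]
  exact sub_mem (LinearMap.mem_range_self _ b) (hrange (LinearMap.mem_range_self l _))

/-- A surjection with a section splits off its target. -/
def LinearMap.equivProdKerOfSection {R M F : Type*} [Ring R] [AddCommGroup M] [Module R M]
    [AddCommGroup F] [Module R F] (f : M →ₗ[R] F) (s : F →ₗ[R] M) (h : f ∘ₗ s = LinearMap.id) :
    M ≃ₗ[R] F × LinearMap.ker f :=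
  have h' : ∀ y, f (s y) = y := LinearMap.congr_fun h
  LinearEquiv.ofLinearMap
    (f.prod ((LinearMap.id - s ∘ₗ f).codRestrict (LinearMap.ker f) fun x => by simp [h']))
    (s.coprod (LinearMap.ker f).subtype)
    (by ext x <;> simp [h'])
    (by ext x; simp)

section Swindle

variable {R : Type*} [CommRing R]

/-- `P^(ℕ) ≃ P × P^(ℕ)`. -/
def Finsupp.natLinearEquivProd (R P : Type*) [CommRing R] [AddCommGroup P] [Module R P] :
    (ℕ →₀ P) ≃ₗ[R] P × (ℕ →₀ P) :=
  (Finsupp.domLCongr Equiv.natSumPUnitEquivNat.{0}.symm).trans <|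
    (Finsupp.sumFinsuppLEquivProdFinsupp R).trans <|
      ((LinearEquiv.refl R _).prodCongr (Finsupp.uniqueLinearEquiv R P PUnit.unit)).trans <|
        LinearEquiv.prodComm R _ _

/-- `(P × P')^(ι) ≃ P^(ι) × P'^(ι)`. -/
def Finsupp.codProdLinearEquiv (R ι P P' : Type*) [CommRing R] [AddCommGroup P] [Module R P]
    [AddCommGroup P'] [Module R P'] : (ι →₀ P × P') ≃ₗ[R] (ι →₀ P) × (ι →₀ P') :=
  LinearEquiv.ofLinearMap
    ((Finsupp.mapRange.linearMap (LinearMap.fst R P P')).prod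
      (Finsupp.mapRange.linearMap (LinearMap.snd R P P')))
    ((Finsupp.mapRange.linearMap (LinearMap.inl R P P')).coprod
      (Finsupp.mapRange.linearMap (LinearMap.inr R P P')))
    (by ext <;> simp) (by ext <;> simp)

/-- The Eilenberg swindle: a countable projective module which has a free quotient of infinite
rank is free. -/
theorem Module.Projective.nonempty_equiv_finsupp_nat {Q : Type*} [AddCommGroup Q] [Module R Q]
    [Countable Q] [Module.Projective R Q] (f : Q →ₗ[R] (ℕ →₀ R)) (hf : Function.Surjective f) :
    Nonempty (Q ≃ₗ[R] (ℕ →₀ R)) := by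
  obtain ⟨u, hu⟩ := exists_surjective_nat Q
  let g : (ℕ →₀ R) →ₗ[R] Q := Finsupp.linearCombination R u
  have hg : Function.Surjective g := fun x => by
    obtain ⟨n, rfl⟩ := hu x
    exact ⟨Finsupp.single n 1, by simp [g]⟩
  obtain ⟨s, hs⟩ := f.exists_rightInverse_of_surjective (LinearMap.range_eq_top.2 hf)
  obtain ⟨s', hs'⟩ := g.exists_rightInverse_of_surjective (LinearMap.range_eq_top.2 hg)
  let F := ℕ →₀ R
  -- `F ≃ Q × Z`, `Q ≃ F × Q'`, `F ≃ F^(ℕ)` and `F ≃ F × F`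
  let e₁ : F ≃ₗ[R] Q × LinearMap.ker g := g.equivProdKerOfSection s' hs'
  let e₂ : Q ≃ₗ[R] F × LinearMap.ker f := f.equivProdKerOfSection s hs
  let e₃ : F ≃ₗ[R] (ℕ →₀ F) :=
    (Finsupp.domLCongr (Denumerable.eqv (ℕ × ℕ)).symm).trans (Finsupp.curryLinearEquiv R)
  let e₄ : F ≃ₗ[R] F × F :=
    (Finsupp.domLCongr (Denumerable.eqv (ℕ ⊕ ℕ)).symm).trans (Finsupp.sumFinsuppLEquivProdFinsupp R)
  let e₅ : F ≃ₗ[R] (ℕ →₀ Q) × (ℕ →₀ LinearMap.ker g) :=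
    (e₃.trans (Finsupp.mapRange.linearEquiv e₁)).trans 
      (Finsupp.codProdLinearEquiv R ℕ Q (LinearMap.ker g))
  let e₆ : F ≃ₗ[R] Q × F :=
    e₅.trans <| ((Finsupp.natLinearEquivProd R Q).prodCongr (LinearEquiv.refl R _)).trans <|
      (LinearEquiv.prodAssoc R _ _ _).trans ((LinearEquiv.refl R Q).prodCongr e₅.symm)
  exact ⟨e₂.trans <| (e₄.prodCongr (LinearEquiv.refl R _)).trans <|
    (LinearEquiv.prodAssoc R _ _ _).trans <| ((LinearEquiv.refl R F).prodCongr e₂.symm).trans <|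
    (LinearEquiv.prodComm R _ _).trans e₆.symm⟩

end Swindle

variable {M : Type*} [AddCommGroup M] [Module A M]

/-- If all saturations of finitely generated submodules of `M` are finitely generated and proper,
then a saturated finitely generated `N` can be enlarged by a projective direct summand `P` with a
free quotient of rank one, so as to contain a given element. -/
theorem Submodule.exists_saturated_extension
    (hfg : ∀ N : Submodule A M, N.FG → N.saturation.FG)
    (htop : ∀ N : Submodule A M, N.FG → N.saturation ≠ ⊤)
    {N : Submodule A M} (hN : N.FG) (hsat : N.saturation = N) (x : M) :
    ∃ P : Submodule A M, (N ⊔ P).FG ∧ (N ⊔ P).saturation = N ⊔ P ∧ x ∈ N ⊔ P ∧ Disjoint N P ∧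
      Module.Projective A P ∧ ∃ f : P →ₗ[A] A, Function.Surjective f := by
  have hext : ∀ N : Submodule A M, N.FG → ∃ y, y ∉ N.saturation := fun N hN => by
    by_contra! h
    exact htop N hN (eq_top_iff.2 fun y _ => h y)
  have hspan : ∀ y : M, (span A {y}).FG := fun y => fg_span_singleton y
  obtain ⟨y, hy⟩ := hext N hN
  obtain ⟨z, hz⟩ := hext _ (hN.sup (hspan y))
  set N' := (N ⊔ span A {x} ⊔ span A {y} ⊔ span A {z}).saturation with hN'
  have hle : N ⊔ span A {x} ⊔ span A {y} ⊔ span A {z} ≤ N' := le_saturation _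
  simp only [sup_le_iff, span_singleton_le_iff_mem] at hle
  obtain ⟨⟨⟨hNN', hx'⟩, hy'⟩, hz'⟩ := hle
  have hfg' : N'.FG := hfg _ (((hN.sup (hspan x)).sup (hspan y)).sup (hspan z))
  have hsat' : N'.saturation = N' := by
    refine le_antisymm (fun w hw => ?_) (le_saturation _)
    obtain ⟨b, hb, h⟩ := mem_saturation.1 hw
    exact mem_of_smul_mem_saturation hb h
  have htf : Module.IsTorsionFree A (M ⧸ N) := by
    refine Submodule.isTorsionFree_iff_torsion_eq_bot.2 (eq_bot_iff.2 fun w hw => ?_)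
    obtain ⟨w, rfl⟩ := N.mkQ_surjective w
    have : w ∈ N.saturation := hw
    rw [hsat] at this
    simpa using this
  let B := N'.map N.mkQ
  have hB : Module.Finite A B := Module.Finite.iff_fg.2 (hfg'.map _)
  let g : N' →ₗ[A] B := N.mkQ.submoduleMap N'
  obtain ⟨s, hs⟩ := g.exists_rightInverse_of_surjective
    (LinearMap.range_eq_top.2 (N.mkQ.submoduleMap_surjective N'))
  have hs' : ∀ b : B, N.mkQ (s b) = b := fun b => congrArg Subtype.val (LinearMap.congr_fun hs b)
  let σ : B →ₗ[A] M := N'.subtype ∘ₗ s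
  have hσ : Function.Injective σ := fun b b' h => Subtype.ext (by
    rw [← hs' b, ← hs' b']
    exact congrArg N.mkQ h)
  have e : B ≃ₗ[A] LinearMap.range σ := LinearEquiv.ofInjective σ hσ
  have hsup : N ⊔ LinearMap.range σ = N' := by
    refine le_antisymm (sup_le hNN' ?_) fun w hw => ?_
    · rintro _ ⟨b, rfl⟩
      exact (s b).2
    · have hwB : N.mkQ w ∈ B := mem_map_of_mem hw
      have : w - σ ⟨N.mkQ w, hwB⟩ ∈ N := by
        rw [← Quotient.mk_eq_zero, ← mkQ_apply, map_sub, sub_eq_zero]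
        exact (hs' ⟨N.mkQ w, hwB⟩).symm
      rw [← sub_add_cancel w (σ ⟨N.mkQ w, hwB⟩)]
      exact add_mem (mem_sup_left this) (mem_sup_right (LinearMap.mem_range_self _ _))
  refine ⟨LinearMap.range σ, by rwa [hsup], by rwa [hsup], by rwa [hsup], ?_,
    Module.Projective.of_equiv e, ?_⟩
  · rw [disjoint_def]
    rintro _ hw ⟨b, rfl⟩
    have h0 : (b : M ⧸ N) = 0 := by
      rw [← hs' b]
      exact (Quotient.mk_eq_zero N).2 hw
    rw [show b = 0 from Subtype.ext h0, map_zero]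
  · have hyz : LinearIndependent A ![(⟨N.mkQ y, mem_map_of_mem hy'⟩ : B),
        ⟨N.mkQ z, mem_map_of_mem hz'⟩] := by
      refine LinearIndependent.pair_iff.2 fun a b hab => ?_
      have hab' : a • y + b • z ∈ N := by
        have := congrArg Subtype.val hab
        rw [← Quotient.mk_eq_zero]
        simpa using this
      have hb : b = 0 := by
        by_contra hb
        refine hz (mem_saturation.2 ⟨b, hb, ?_⟩)
        rw [← add_sub_cancel_left (a • y) (b • z)]
        exact sub_mem (mem_sup_left hab') (mem_sup_right (smul_mem _ _ (mem_span_singleton_self y)))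
      subst hb
      refine ⟨?_, rfl⟩
      by_contra ha
      exact hy (mem_saturation.2 ⟨a, ha, by simpa using hab'⟩)
    obtain ⟨f, hf⟩ := IsDedekindDomain.exists_linearMap_surjective hyz
    exact ⟨f ∘ₗ e.symm, hf.comp e.symm.surjective⟩

/-- A countable module over a Dedekind domain in which the saturations of finitely generated
submodules are finitely generated and proper is the direct sum of its torsion submodule and a free
module of rank `ℵ₀`. -/
theorem Submodule.exists_isCompl_torsion [Countable M]
    (hfg : ∀ N : Submodule A M, N.FG → N.saturation.FG)
    (htop : ∀ N : Submodule A M, N.FG → N.saturation ≠ ⊤) :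
    ∃ N : Submodule A M, IsCompl (torsion A M) N ∧ Nonempty (N ≃ₗ[A] (ℕ →₀ A)) := by
  classical
  obtain ⟨x, hx⟩ := exists_surjective_nat M
  have hext := fun (N : {N : Submodule A M // N.FG ∧ N.saturation = N}) (x : M) =>
    exists_saturated_extension hfg htop N.2.1 N.2.2 x
  choose E hE₁ hE₂ hE₃ hE₄ hE₅ hE₆ using hext
  have h0 : (torsion A M).FG ∧ (torsion A M).saturation = torsion A M := by
    rw [← saturation_bot]
    refine ⟨hfg _ fg_bot, le_antisymm (fun w hw => ?_) (le_saturation _)⟩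
    obtain ⟨b, hb, h⟩ := mem_saturation.1 hw
    exact mem_of_smul_mem_saturation hb h
  -- an increasing chain of saturated finitely generated submodules that starts with the torsion and
  -- exhausts `M`; its successive complements are the `P k`
  let N : ℕ → {N : Submodule A M // N.FG ∧ N.saturation = N} := fun n =>
    n.rec ⟨torsion A M, h0⟩ fun k N => ⟨N.1 ⊔ E N (x k), hE₁ N (x k), hE₂ N (x k)⟩
  let P : ℕ → Submodule A M := fun k => E (N k) (x k)
  have hsucc : ∀ k, (N (k + 1)).1 = (N k).1 ⊔ P k := fun k => rfl
  have hmono : Monotone fun k => (N k).1 := monotone_nat_of_le_succ fun k => by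
    rw [hsucc]
    exact le_sup_left
  have hP : ∀ j k, j < k → P j ≤ (N k).1 := fun j k hjk =>
    le_trans (le_sup_right.trans (hsucc j).ge) (hmono (Nat.succ_le_of_lt hjk))
  let Φ : (Π₀ k, P k) →ₗ[A] M := DFinsupp.lsum ℕ fun k => (P k).subtype
  have hΦ : ∀ w, Φ w = ∑ k ∈ w.support, (w k : M) := fun w => by
    simp only [Φ, DFinsupp.lsum_apply_apply, DFinsupp.sumAddHom_apply]
    rfl
  -- the summand of highest index of an element of the kernel lies in `N k ⊓ P k`
  have hinj : ∀ w, Φ w ∈ torsion A M → w = 0 := fun w hw => by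
    by_contra hne
    have hsupp : w.support.Nonempty := by
      rwa [Finset.nonempty_iff_ne_empty, Ne, DFinsupp.support_eq_empty]
    let k := w.support.max' hsupp
    have hk : k ∈ w.support := Finset.max'_mem _ _
    have hmem : (w k : M) ∈ (N k).1 := by
      have h1 := hΦ w
      rw [← Finset.add_sum_erase _ _ hk] at h1
      rw [eq_sub_of_add_eq h1.symm]
      refine sub_mem (hmono (Nat.zero_le k) hw) (sum_mem fun j hj => hP j k ?_ (w j).2)
      exact lt_of_le_of_ne (Finset.le_max' _ _ (Finset.mem_of_mem_erase hj))
        (Finset.ne_of_mem_erase hj)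
    exact (DFinsupp.mem_support_iff.1 hk)
      (Subtype.ext (disjoint_def.1 (hE₄ (N k) (x k)) _ hmem (w k).2))
  have hle : ∀ k, (N k).1 ≤ torsion A M ⊔ LinearMap.range Φ := fun k => by
    induction k with
    | zero => exact le_sup_left
    | succ k ih =>
      rw [hsucc]
      refine sup_le ih fun w hw => mem_sup_right ⟨DFinsupp.single k ⟨w, hw⟩, ?_⟩
      simp [Φ]
  refine ⟨LinearMap.range Φ, ⟨?_, ?_⟩, ?_⟩
  · rw [disjoint_def]
    rintro _ hw ⟨w, rfl⟩
    rw [hinj w hw, map_zero]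
  · rw [codisjoint_iff, eq_top_iff]
    intro w _
    obtain ⟨k, rfl⟩ := hx w
    exact hle (k + 1) (hE₃ (N k) (x k))
  · have hΦi : Function.Injective Φ := (injective_iff_map_eq_zero Φ).2 fun w hw =>
      hinj w (by rw [hw]; exact zero_mem _)
    let e : (Π₀ k, P k) ≃ₗ[A] LinearMap.range Φ := LinearEquiv.ofInjective Φ hΦi
    have hproj : ∀ k, Module.Projective A (P k) := fun k => hE₅ (N k) (x k)
    have hcount : Countable (Π₀ k, P k) := e.toEquiv.countable_iff.2 inferInstance
    choose f hf using fun k => hE₆ (N k) (x k)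
    -- the direct sum of the `P k` maps onto the direct sum of their free quotients
    obtain ⟨e'⟩ := Module.Projective.nonempty_equiv_finsupp_nat
      ((finsuppLequivDFinsupp A).symm.toLinearMap ∘ₗ DFinsupp.mapRange.linearMap f)
      ((finsuppLequivDFinsupp A).symm.surjective.comp
        ((DFinsupp.mapRange_surjective _ fun k => map_zero (f k)).2 hf))
    exact ⟨e.symm.trans e'⟩

/-! ### Heights on modules over a polynomial ring -/

section Height

open Polynomial

/-- A height on a module over `k[X]` for which `X` multiplies heights by at most `Q`, up to a
bounded error. -/
structure IsModuleHeight {k M : Type*} [Field k] [AddCommGroup M] [Module k[X] M] (Q : ℝ)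
    (h : M → ℝ) : Prop where
  two_le : 2 ≤ Q
  nonneg : ∀ x, 0 ≤ h x
  neg : ∀ x, h (-x) = h x
  add_le : ∀ x y, h (x + y) ≤ h x + h y
  exists_C_smul_le : ∃ c, 0 ≤ c ∧ ∀ (a : k) x, h (C a • x) ≤ c * h x
  exists_X_smul_le : ∃ D, 0 ≤ D ∧ ∀ x, h ((X : k[X]) • x) ≤ Q * h x + D

variable {k M : Type*} [Field k] [AddCommGroup M] [Module k[X] M] {Q : ℝ} {h : M → ℝ}

variable (k) in
/-- The elements of canonical height at most `c`: the height of `X ^ n • x` is at most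
`c * Q ^ n` up to a constant. The canonical height itself, the limit of `h (X ^ n • x) / Q ^ n`, is
not needed. -/
def canonicalHeightLE (Q : ℝ) (h : M → ℝ) (c : ℝ) : Set M :=
  {x | ∃ D, ∀ n : ℕ, h ((X ^ n : k[X]) • x) ≤ c * Q ^ n + D}

theorem Polynomial.finite_degreeLT (k : Type*) [Field k] [Finite k] (n : ℕ) :
    (degreeLT k n : Set k[X]).Finite :=
  have : Finite (degreeLT k n) := Finite.of_equiv _ (degreeLTEquiv k n).toEquiv.symm
  Set.toFinite _

namespace IsModuleHeight

protected theorem add_mem (H : IsModuleHeight (k := k) Q h) {c c' : ℝ} {x y : M}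
    (hx : x ∈ canonicalHeightLE k Q h c) (hy : y ∈ canonicalHeightLE k Q h c') :
    x + y ∈ canonicalHeightLE k Q h (c + c') := by
  obtain ⟨D, hD⟩ := hx
  obtain ⟨D', hD'⟩ := hy
  refine ⟨D + D', fun n => ?_⟩
  rw [smul_add]
  linarith [H.add_le ((X ^ n : k[X]) • x) ((X ^ n : k[X]) • y), hD n, hD' n]

protected theorem neg_mem (H : IsModuleHeight (k := k) Q h) {c : ℝ} {x : M}
    (hx : x ∈ canonicalHeightLE k Q h c) : -x ∈ canonicalHeightLE k Q h c := by
  obtain ⟨D, hD⟩ := hx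
  exact ⟨D, fun n => by rw [smul_neg, H.neg]; exact hD n⟩

protected theorem mono (H : IsModuleHeight (k := k) Q h) {c c' : ℝ} (hc : c ≤ c') :
    canonicalHeightLE k Q h c ⊆ canonicalHeightLE k Q h c' := by
  rintro x ⟨D, hD⟩
  refine ⟨D, fun n => (hD n).trans ?_⟩
  have : 0 ≤ Q ^ n := pow_nonneg (by linarith [H.two_le]) n
  gcongr

theorem mem_of_X_pow_smul_mem (H : IsModuleHeight (k := k) Q h) {c : ℝ} {x : M} {n : ℕ}
    (hc : 0 ≤ c) (hx : (X ^ n : k[X]) • x ∈ canonicalHeightLE k Q h c) :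
    x ∈ canonicalHeightLE k Q h (c / Q ^ n) := by
  obtain ⟨D, hD⟩ := hx
  have hQ : 0 < Q := by linarith [H.two_le]
  have hD0 : 0 ≤ |D| := abs_nonneg D
  have hsum : 0 ≤ ∑ j ∈ Finset.range n, h ((X ^ j : k[X]) • x) :=
    Finset.sum_nonneg fun j _ => H.nonneg _
  refine ⟨|D| + ∑ j ∈ Finset.range n, h ((X ^ j : k[X]) • x), fun j => ?_⟩
  by_cases hj : j < n
  · have h1 := Finset.single_le_sum (f := fun j => h ((X ^ j : k[X]) • x))
      (fun j _ => H.nonneg _) (Finset.mem_range.2 hj)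
    have h2 : 0 ≤ c / Q ^ n * Q ^ j := by positivity
    linarith
  · obtain ⟨m, rfl⟩ := Nat.exists_eq_add_of_le (not_lt.1 hj)
    have h1 := hD m
    rw [smul_smul, ← pow_add, add_comm m n] at h1
    have h2 : c / Q ^ n * Q ^ (n + m) = c * Q ^ m := by
      rw [pow_add]
      field_simp
    rw [h2]
    linarith [le_abs_self D]

/-- Elements `e • x` with `deg e < n` have height `O(Q ^ n)`. -/
theorem exists_smul_le (H : IsModuleHeight (k := k) Q h) (x : M) :
    ∃ B, 0 ≤ B ∧ ∀ n, ∀ e ∈ degreeLT k n, h (e • x) ≤ B * Q ^ n := by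
  obtain ⟨c, hc, hC⟩ := H.exists_C_smul_le
  obtain ⟨D, hD, hX⟩ := H.exists_X_smul_le
  have hQ := H.two_le
  have hx := H.nonneg x
  have hpow : ∀ n : ℕ, h ((X ^ n : k[X]) • x) + D ≤ (h x + D) * Q ^ n := fun n => by
    induction n with
    | zero => simp
    | succ n ih =>
      have h1 := hX ((X ^ n : k[X]) • x)
      rw [smul_smul, ← pow_succ'] at h1
      have h3 : Q * D ≥ 2 * D := by gcongr
      have h2 : Q * (h ((X ^ n : k[X]) • x) + D) ≤ Q * ((h x + D) * Q ^ n) := by gcongr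
      have h4 : (h x + D) * Q ^ (n + 1) = Q * ((h x + D) * Q ^ n) := by ring
      linarith
  have h00 : h (0 : M) ≤ c * h x := by simpa using hC 0 x
  refine ⟨c * (h x + D), by positivity, fun n => ?_⟩
  induction n with
  | zero =>
    intro e he
    have : e = 0 := by simpa [mem_degreeLT] using he
    rw [this, zero_smul, pow_zero, mul_one]
    nlinarith
  | succ n ih =>
    intro e he
    have hsplit : e = C (e.coeff n) * X ^ n + (e - C (e.coeff n) * X ^ n) := by ring
    have hlow : e - C (e.coeff n) * X ^ n ∈ degreeLT k n := by
      rw [mem_degreeLT, degree_lt_iff_coeff_zero]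
      intro m hm
      rw [coeff_sub, coeff_C_mul_X_pow]
      split_ifs with hmn
      · rw [hmn, sub_self]
      · rw [mem_degreeLT, degree_lt_iff_coeff_zero] at he
        rw [he m (by omega), sub_zero]
    rw [hsplit, add_smul, mul_smul]
    have h1 := H.add_le (C (e.coeff n) • (X ^ n : k[X]) • x) ((e - C (e.coeff n) * X ^ n) • x)
    have h2 := hC (e.coeff n) ((X ^ n : k[X]) • x)
    have h3 := ih _ hlow
    have h4 : c * h ((X ^ n : k[X]) • x) ≤ c * ((h x + D) * Q ^ n) := by
      gcongr
      linarith [hpow n]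
    have h5 : 0 ≤ c * (h x + D) * Q ^ n := by positivity
    rw [pow_succ]
    nlinarith

variable [Finite k]

variable (Q h) in
/-- If `b • x = 0`, then the `X ^ n • x` are among the finitely many `r • x` with
`deg r < deg b`. -/
theorem _root_.torsion_subset_canonicalHeightLE :
    (Submodule.torsion k[X] M : Set M) ⊆ canonicalHeightLE k Q h 0 := by
  intro x hx
  rw [SetLike.mem_coe, Submodule.mem_torsion_iff] at hx
  obtain ⟨⟨b, hb⟩, hbx⟩ := hx
  have hb0 : b ≠ 0 := nonZeroDivisors.ne_zero hb
  obtain ⟨D, hD⟩ := ((finite_degreeLT k b.natDegree).image fun r => h (r • x)).bddAbove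
  refine ⟨D, fun n => ?_⟩
  have h1 : (X ^ n : k[X]) • x = (X ^ n % b) • x := by
    conv_lhs => rw [← EuclideanDomain.mod_add_div (X ^ n) b, add_smul, mul_comm, mul_smul]
    rw [show b • x = 0 from hbx, smul_zero, add_zero]
  rw [h1, zero_mul, zero_add]
  refine hD ⟨_, ?_, rfl⟩
  rw [SetLike.mem_coe, mem_degreeLT, ← degree_eq_natDegree hb0]
  exact EuclideanDomain.mod_lt _ hb0

/-- If only finitely many elements have small canonical height, then the torsion is finite. -/
theorem finite_torsion (H : IsModuleHeight (k := k) Q h) {ε : ℝ} (hε : 0 < ε)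
    (hfin : (canonicalHeightLE k Q h ε).Finite) : (Submodule.torsion k[X] M : Set M).Finite :=
  hfin.subset ((torsion_subset_canonicalHeightLE Q h).trans (H.mono hε.le))

/-- Every element of the saturation of `span x` is congruent modulo `span x` to an element whose
canonical height is bounded in terms of `x` alone: division with remainder replaces
`z = ∑ (rᵢ / b) xᵢ` by an element with `deg rᵢ < deg b`. -/
theorem exists_sub_mem (H : IsModuleHeight (k := k) Q h)
    (htors : (Submodule.torsion k[X] M : Set M).Finite) {ι : Type*} [Finite ι] (x : ι → M) :
    ∃ c, 0 ≤ c ∧ ∀ z ∈ (Submodule.span k[X] (Set.range x)).saturation,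
      ∃ m ∈ Submodule.span k[X] (Set.range x), z - m ∈ canonicalHeightLE k Q h c := by
  have := Fintype.ofFinite ι
  choose B hB0 hB using fun i => H.exists_smul_le (x i)
  refine ⟨∑ i, B i, Finset.sum_nonneg fun i _ => hB0 i, fun z hz => ?_⟩
  obtain ⟨b, hb, hbz⟩ := Submodule.mem_saturation.1 hz
  obtain ⟨r, hr⟩ := (Submodule.mem_span_range_iff_exists_fun k[X]).1 hbz
  refine ⟨∑ i, (r i / b) • x i,
    (Submodule.mem_span_range_iff_exists_fun k[X]).2 ⟨_, rfl⟩, ?_⟩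
  set z' := z - ∑ i, (r i / b) • x i with hz'
  have hbz' : b • z' = ∑ i, (r i % b) • x i := by
    rw [hz', smul_sub, ← hr, Finset.smul_sum, ← Finset.sum_sub_distrib]
    refine Finset.sum_congr rfl fun i _ => ?_
    rw [smul_smul, ← sub_smul, EuclideanDomain.mod_eq_sub_mul_div]
  -- the elements with `b • w` a combination of the `x i` with coefficients of degree `< deg b`
  have hW : {w : M | ∃ s : ι → k[X], (∀ i, s i ∈ degreeLT k b.natDegree) ∧
      b • w = ∑ i, s i • x i}.Finite := by
    have hS : {s : ι → k[X] | ∀ i, s i ∈ degreeLT k b.natDegree}.Finite := by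
      refine (Set.Finite.pi fun _ : ι => finite_degreeLT k b.natDegree).subset fun s hs i _ => hs i
    refine ((hS.image fun s => ∑ i, s i • x i).preimage' (f := fun w : M => b • w)
      fun y _ => ?_).subset fun w ⟨s, hs, hw⟩ => ⟨s, hs, hw.symm⟩
    rcases Set.eq_empty_or_nonempty ((fun w : M => b • w) ⁻¹' {y}) with he | ⟨w₀, hw₀⟩
    · rw [he]
      exact Set.finite_empty
    · refine (htors.image fun t => w₀ + t).subset fun w hw => ⟨w - w₀, ?_, by simp⟩
      have h1 : b • w = b • w₀ :=
        (Set.mem_singleton_iff.1 hw).trans (Set.mem_singleton_iff.1 hw₀).symm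
      exact (Submodule.mem_torsion_iff _).2 ⟨⟨b, mem_nonZeroDivisors_of_ne_zero hb⟩,
        by rw [Submonoid.mk_smul, smul_sub, h1, sub_self]⟩
  obtain ⟨D, hD⟩ := (hW.image h).bddAbove
  refine ⟨D + h 0, fun n => ?_⟩
  -- up to the finite set `hW`, the element `X ^ n • z'` is a combination of the `x i` with
  -- coefficients of degree `< n`
  let e : ι → k[X] := fun i => (X ^ n * (r i % b)) / b
  have he : ∀ i, e i ∈ degreeLT k n := fun i => by
    rw [mem_degreeLT]
    have hlt : (r i % b).degree < b.degree := EuclideanDomain.mod_lt _ hb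
    by_cases hdeg : b.degree ≤ (X ^ n * (r i % b)).degree
    · have h1 := degree_add_div hb hdeg
      rw [degree_mul, degree_X_pow] at h1
      by_contra hcon
      rw [not_lt] at hcon
      have h2 : b.degree + n ≤ n + (r i % b).degree := h1 ▸ (by gcongr)
      rw [add_comm] at h2
      have hne : (n : WithBot ℕ) ≠ ⊥ := WithBot.natCast_ne_bot n
      exact absurd ((WithBot.add_le_add_iff_left hne).1 h2) (not_le.2 hlt)
    · rw [show e i = 0 from (Polynomial.div_eq_zero_iff hb).2 (not_le.1 hdeg), degree_zero]
      exact WithBot.bot_lt_coe n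
  have hw : (X ^ n : k[X]) • z' - ∑ i, e i • x i ∈ {w : M | ∃ s : ι → k[X],
      (∀ i, s i ∈ degreeLT k b.natDegree) ∧ b • w = ∑ i, s i • x i} := by
    refine ⟨fun i => (X ^ n * (r i % b)) % b, fun i => ?_, ?_⟩
    · rw [mem_degreeLT, ← degree_eq_natDegree hb]
      exact EuclideanDomain.mod_lt _ hb
    · rw [smul_sub, smul_comm, hbz', Finset.smul_sum, Finset.smul_sum, ← Finset.sum_sub_distrib]
      refine Finset.sum_congr rfl fun i _ => ?_
      rw [smul_smul, smul_smul, ← sub_smul, ← EuclideanDomain.mod_eq_sub_mul_div]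
  have hsum : ∀ s : Finset ι, h (∑ i ∈ s, e i • x i) ≤ (∑ i ∈ s, B i) * Q ^ n + h 0 := fun s => by
    classical
    induction s using Finset.induction_on with
    | empty => simp
    | insert i s hi ih =>
      rw [Finset.sum_insert hi, Finset.sum_insert hi]
      linarith [H.add_le (e i • x i) (∑ i ∈ s, e i • x i), hB i n (e i) (he i)]
  have h1 := H.add_le ((X ^ n : k[X]) • z' - ∑ i, e i • x i) (∑ i, e i • x i)
  rw [sub_add_cancel] at h1
  have h2 := hD ⟨_, hw, rfl⟩
  linarith [hsum Finset.univ]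

/-- If only finitely many elements have small canonical height, then the saturation of a finitely
generated submodule is finitely generated: an element of bounded canonical height is divided by
`X ^ n`, which leaves an element of small canonical height and a bounded remainder. -/
theorem fg_saturation (H : IsModuleHeight (k := k) Q h) {ε : ℝ} (hε : 0 < ε)
    (hfin : (canonicalHeightLE k Q h ε).Finite) {N : Submodule k[X] M} (hN : N.FG) :
    N.saturation.FG := by
  obtain ⟨l, x, rfl⟩ := Submodule.fg_iff_exists_fin_generating_family.1 hN
  obtain ⟨c, hc, hmem⟩ := H.exists_sub_mem (H.finite_torsion hε hfin) x
  have hQ := H.two_le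
  obtain ⟨n, hn⟩ : ∃ n : ℕ, (c + c) / Q ^ n ≤ ε := by
    obtain ⟨n, hn⟩ := pow_unbounded_of_one_lt ((c + c) / ε) (by linarith : 1 < Q)
    refine ⟨n, ?_⟩
    have : 0 < Q ^ n := by positivity
    rw [div_le_iff₀ this]
    rw [div_lt_iff₀ hε] at hn
    linarith
  -- the combinations of the `x i` with coefficients of degree `< n`
  have hP : {m : M | ∃ s : Fin l → k[X], (∀ i, s i ∈ degreeLT k n) ∧
      m = ∑ i, s i • x i}.Finite := by
    have hS : {s : Fin l → k[X] | ∀ i, s i ∈ degreeLT k n}.Finite :=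
      (Set.Finite.pi fun _ : Fin l => finite_degreeLT k n).subset fun s hs i _ => hs i
    exact (hS.image fun s => ∑ i, s i • x i).subset fun m ⟨s, hs, hm⟩ => ⟨s, hs, hm.symm⟩
  -- two elements of one fibre differ by an element of canonical height at most `2 c / Q ^ n`
  have hG : ∀ m : M, {y : M | (X ^ n : k[X]) • y - m ∈ canonicalHeightLE k Q h c}.Finite := by
    intro m
    rcases Set.eq_empty_or_nonempty
      {y : M | (X ^ n : k[X]) • y - m ∈ canonicalHeightLE k Q h c} with he | ⟨y₀, hy₀⟩
    · rw [he]
      exact Set.finite_empty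
    refine (hfin.image fun t => y₀ + t).subset fun y hy => ⟨y - y₀, ?_, by simp⟩
    refine H.mono hn (H.mem_of_X_pow_smul_mem (add_nonneg hc hc) ?_)
    have := H.add_mem hy (H.neg_mem hy₀)
    rwa [← sub_eq_add_neg, sub_sub_sub_cancel_right, ← smul_sub] at this
  have hZ := hP.biUnion fun m _ => hG m
  refine Submodule.FG.of_le (hN.sup (Submodule.fg_span hZ)) fun z hz => ?_
  obtain ⟨m, hm, hzm⟩ := hmem _ (Submodule.smul_mem _ (X ^ n : k[X]) hz)
  obtain ⟨r, rfl⟩ := (Submodule.mem_span_range_iff_exists_fun k[X]).1 hm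
  have hX0 : (X ^ n : k[X]) ≠ 0 := pow_ne_zero n X_ne_zero
  rw [← sub_add_cancel z (∑ i, (r i / X ^ n) • x i), add_comm]
  refine add_mem (Submodule.mem_sup_left ((Submodule.mem_span_range_iff_exists_fun k[X]).2
    ⟨_, rfl⟩)) (Submodule.mem_sup_right (Submodule.subset_span ?_))
  refine Set.mem_biUnion (x := ∑ i, (r i % X ^ n) • x i) ⟨_, fun i => ?_, rfl⟩ ?_
  · rw [mem_degreeLT, ← degree_X_pow (R := k) n]
    exact EuclideanDomain.mod_lt _ hX0
  · have : (X ^ n : k[X]) • (z - ∑ i, (r i / X ^ n) • x i) - ∑ i, (r i % X ^ n) • x i =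
        (X ^ n : k[X]) • z - ∑ i, r i • x i := by
      rw [smul_sub, sub_sub, Finset.smul_sum, ← Finset.sum_add_distrib]
      congr 1
      refine Finset.sum_congr rfl fun i _ => ?_
      rw [smul_smul, ← add_smul, EuclideanDomain.div_add_mod]
    rw [Set.mem_ofPred_eq, this]
    exact hzm

end IsModuleHeight

end Height

/-! ### Additive polynomials over non-archimedean fields -/

section Additive

open Polynomial

variable {E : Type*} [Field E] {ν : AbsoluteValue E ℝ}

/-- If all terms of `P` are bounded by `S` and all terms of `P'` by `S'` on the circle of radius
`R`, then the terms of `P * P'` are bounded by `S * S'`. -/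
theorem IsNonarchimedean.coeff_mul_le (hν : IsNonarchimedean ν) {R S S' : ℝ} (hR : 0 ≤ R)
    {P P' : E[X]} (hP : ∀ k, ν (P.coeff k) * R ^ k ≤ S) (hP' : ∀ k, ν (P'.coeff k) * R ^ k ≤ S')
    (k : ℕ) : ν ((P * P').coeff k) * R ^ k ≤ S * S' := by
  have hS : 0 ≤ S := le_trans (by positivity) (hP 0)
  rw [coeff_mul]
  obtain ⟨⟨i, j⟩, hij, hle⟩ := hν.finset_image_add_of_nonempty
    (fun x : ℕ × ℕ => P.coeff x.1 * P'.coeff x.2) (t := Finset.HasAntidiagonal.antidiagonal k)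
    ⟨(0, k), by simp⟩
  rw [Finset.HasAntidiagonal.mem_antidiagonal] at hij
  calc ν (∑ x ∈ Finset.HasAntidiagonal.antidiagonal k, P.coeff x.1 * P'.coeff x.2) * R ^ k
      ≤ ν (P.coeff i * P'.coeff j) * R ^ k := by gcongr
    _ = (ν (P.coeff i) * R ^ i) * (ν (P'.coeff j) * R ^ j) := by
        rw [map_mul, ← hij, pow_add]
        ring
    _ ≤ S * S' := mul_le_mul (hP i) (hP' j) (by positivity) hS

theorem IsNonarchimedean.coeff_prod_le (hν : IsNonarchimedean ν) {R : ℝ} (hR : 0 ≤ R)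
    {ι : Type*} (s : Finset ι) {P : ι → E[X]} {S : ι → ℝ}
    (hP : ∀ i ∈ s, ∀ k, ν ((P i).coeff k) * R ^ k ≤ S i) :
    ∀ k, ν ((∏ i ∈ s, P i).coeff k) * R ^ k ≤ ∏ i ∈ s, S i := by
  classical
  induction s using Finset.induction_on with
  | empty =>
    intro k
    rw [Finset.prod_empty, Finset.prod_empty, coeff_one]
    split_ifs with h
    · simp [h]
    · simp
  | insert i s hi ih =>
    rw [Finset.prod_insert hi, Finset.prod_insert hi]
    exact hν.coeff_mul_le hR (hP i (Finset.mem_insert_self i s))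
      (ih fun j hj => hP j (Finset.mem_insert_of_mem hj))

theorem IsNonarchimedean.map_sub_le_max (hν : IsNonarchimedean ν) (x y : E) :
    ν (x - y) ≤ max (ν x) (ν y) := by
  rw [sub_eq_add_neg, ← ν.map_neg y]
  exact hν x (-y)

/-- An additive polynomial which is at most `S` at more than `deg f` points with mutual distances
larger than `R` has all its terms bounded by `S` on the disc of radius `R`. This is Lagrange
interpolation, after a translation which moves to `0` the point for which the product of the
distances to the other points is smallest. -/
theorem IsNonarchimedean.coeff_le_of_separated (hν : IsNonarchimedean ν) {R S : ℝ} (hR : 0 < R)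
    {f : E[X]} (hadd : ∀ x y, f.eval (x + y) = f.eval x + f.eval y) {s : Finset E}
    (hcard : f.natDegree < s.card) (hsep : ∀ x ∈ s, ∀ y ∈ s, x ≠ y → R < ν (x - y))
    (hS : ∀ x ∈ s, ν (f.eval x) ≤ S) (k : ℕ) : ν (f.coeff k) * R ^ k ≤ S := by
  classical
  have hne : s.Nonempty := Finset.card_pos.1 (by omega)
  obtain ⟨x₀, hx₀, hmin⟩ := s.exists_min_image (fun x => ∏ y ∈ s.erase x, ν (x - y)) hne
  have hS0 : 0 ≤ S := (ν.nonneg _).trans (hS x₀ hx₀)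
  have hsub : ∀ x, f.eval (x - x₀) = f.eval x - f.eval x₀ := fun x => by
    rw [eq_sub_iff_add_eq, ← hadd, sub_add_cancel]
  let v : E → E := fun x => x - x₀
  have hv : Set.InjOn v s := fun x _ y _ h => sub_left_injective h
  have hint : f = Lagrange.interpolate s v fun x => f.eval (v x) :=
    Lagrange.eq_interpolate hv (degree_le_natDegree.trans_lt (by exact_mod_cast hcard))
  have hbasis : ∀ x ∈ s, ∀ k, ν ((Lagrange.basis s v x).coeff k) * R ^ k ≤ 1 := by
    intro x hx k
    have hdiv : ∀ y ∈ s.erase x, ∀ k, ν ((Lagrange.basisDivisor (v x) (v y)).coeff k) * R ^ k ≤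
        max (ν (y - x₀)) R / ν (x - y) := by
      intro y hy k
      have hyx : x ≠ y := (Finset.ne_of_mem_erase hy).symm
      have hpos : 0 < ν (x - y) := ν.pos (sub_ne_zero.2 hyx)
      rw [Lagrange.basisDivisor, show v x - v y = x - y by simp [v], coeff_C_mul, map_mul, map_inv₀,
        div_eq_inv_mul, mul_assoc]
      refine mul_le_mul_of_nonneg_left ?_ (inv_nonneg.2 hpos.le)
      rcases k with _ | _ | k
      · simp [v, ν.map_sub x₀ y]
      · simp
      · rw [coeff_sub, coeff_X, coeff_C]
        simp [hR.le]
    refine (hν.coeff_prod_le hR.le _ hdiv k).trans ?_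
    rw [Finset.prod_div_distrib]
    have hpos : 0 < ∏ y ∈ s.erase x, ν (x - y) := Finset.prod_pos fun y hy =>
      ν.pos (sub_ne_zero.2 (Finset.ne_of_mem_erase hy).symm)
    refine (div_le_one hpos).2 (le_trans ?_ (hmin x hx))
    by_cases hxx : x = x₀
    · subst hxx
      refine Finset.prod_le_prod (fun y _ => by positivity) fun y hy => ?_
      have hy' := Finset.mem_erase.1 hy
      rw [ν.map_sub y x]
      exact max_le le_rfl (hsep x hx y hy'.2 hy'.1.symm).le
    · have h0x : x₀ ∈ s.erase x := Finset.mem_erase.2 ⟨Ne.symm hxx, hx₀⟩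
      have hx0 : x ∈ s.erase x₀ := Finset.mem_erase.2 ⟨hxx, hx⟩
      rw [← Finset.mul_prod_erase _ _ h0x, ← Finset.mul_prod_erase _ _ hx0,
        Finset.erase_right_comm]
      refine mul_le_mul ?_ (Finset.prod_le_prod (fun y _ => by positivity) fun y hy => ?_)
        (Finset.prod_nonneg fun y _ => by positivity) (ν.nonneg _)
      · rw [sub_self, map_zero, max_eq_right hR.le, ν.map_sub]
        exact (hsep x hx x₀ hx₀ hxx).le
      · have hy' := Finset.mem_erase.1 (Finset.mem_of_mem_erase hy)
        rw [ν.map_sub y x₀]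
        exact max_le le_rfl (hsep x₀ hx₀ y hy'.2 hy'.1.symm).le
  rw [hint, Lagrange.interpolate_apply, finsetSum_coeff]
  obtain ⟨x, hx, hle⟩ := hν.finset_image_add_of_nonempty
    (fun x => (C (f.eval (v x)) * Lagrange.basis s v x).coeff k) hne
  have hfx : ν (f.eval (v x)) ≤ S := by
    rw [hsub]
    exact (hν.map_sub_le_max _ _).trans (max_le (hS x hx) (hS x₀ hx₀))
  calc _ ≤ ν ((C (f.eval (v x)) * Lagrange.basis s v x).coeff k) * R ^ k := by gcongr
    _ = ν (f.eval (v x)) * (ν ((Lagrange.basis s v x).coeff k) * R ^ k) := by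
      rw [coeff_C_mul, map_mul, mul_assoc]
    _ ≤ S * 1 := mul_le_mul hfx (hbasis x hx k) (by positivity) hS0
    _ = S := mul_one S

/-- The set where `g` is at most `S` is covered by finitely many discs of radius `R`. -/
def IsFinitelyCovered (ν : AbsoluteValue E ℝ) (g : E → E) (R S : ℝ) : Prop :=
  ∃ c : Finset E, ∀ x, ν (g x) ≤ S → ∃ y ∈ c, ν (x - y) ≤ R

/-- Otherwise there are arbitrarily large sets of points with `|f| ≤ S` and mutual distances larger
than `R`. -/
theorem IsNonarchimedean.isFinitelyCovered_eval (hν : IsNonarchimedean ν) {R S : ℝ} (hR : 0 < R)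
    {f : E[X]} (hadd : ∀ x y, f.eval (x + y) = f.eval x + f.eval y) {k : ℕ}
    (hk : S < ν (f.coeff k) * R ^ k) : IsFinitelyCovered ν (fun x => f.eval x) R S := by
  classical
  by_contra hcov
  simp only [IsFinitelyCovered, not_exists, not_forall, not_and, not_le] at hcov
  have hsep : ∀ n : ℕ, ∃ s : Finset E, s.card = n ∧
      (∀ x ∈ s, ∀ y ∈ s, x ≠ y → R < ν (x - y)) ∧ ∀ x ∈ s, ν (f.eval x) ≤ S := fun n => by
    induction n with
    | zero => exact ⟨∅, by simp⟩
    | succ n ih =>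
      obtain ⟨s, hs, hsep, hS⟩ := ih
      obtain ⟨x, hx, hxs⟩ := hcov s
      have hxs' : x ∉ s := fun h => by
        have := hxs x h
        rw [sub_self, map_zero] at this
        exact lt_asymm hR this
      refine ⟨insert x s, by rw [Finset.card_insert_of_notMem hxs', hs], fun y hy z hz hyz => ?_,
        fun y hy => ?_⟩
      · rcases Finset.mem_insert.1 hy with rfl | hy <;> rcases Finset.mem_insert.1 hz with rfl | hz
        · exact absurd rfl hyz
        · exact hxs z hz
        · rw [ν.map_sub]
          exact hxs y ‹_›
        · exact hsep y hy z hz hyz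
      · rcases Finset.mem_insert.1 hy with rfl | hy
        · exact hx
        · exact hS y hy
  obtain ⟨s, hs, hsep, hS⟩ := hsep (f.natDegree + 1)
  exact absurd (hν.coeff_le_of_separated hR hadd (by omega) hsep hS k) (not_le.2 hk)

theorem IsNonarchimedean.isFinitelyCovered_comp (hν : IsNonarchimedean ν) {R S S' : ℝ}
    {g g' : E → E} (hadd : ∀ x y, g (x - y) = g x - g y) (h : IsFinitelyCovered ν g R S)
    (h' : IsFinitelyCovered ν g' S S') : IsFinitelyCovered ν (g' ∘ g) R S' := by
  classical
  obtain ⟨c, hc⟩ := h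
  obtain ⟨c', hc'⟩ := h'
  let u : E → E := fun y => if hy : ∃ x, ν (g x - y) ≤ S then hy.choose else 0
  refine ⟨(c ×ˢ c').image fun z => z.1 + u z.2, fun x hx => ?_⟩
  obtain ⟨y, hy, hxy⟩ := hc' (g x) hx
  have hu : ν (g (u y) - y) ≤ S := by
    have hex : ∃ x, ν (g x - y) ≤ S := ⟨x, hxy⟩
    simp only [u, dif_pos hex]
    exact hex.choose_spec
  have hle : ν (g (x - u y)) ≤ S := by
    rw [hadd, ← sub_sub_sub_cancel_right _ _ y]
    exact (hν.map_sub_le_max _ _).trans (max_le hxy hu)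
  obtain ⟨z, hz, hxz⟩ := hc _ hle
  refine ⟨z + u y, Finset.mem_image.2 ⟨(z, y), Finset.mem_product.2 ⟨hz, hy⟩, rfl⟩, ?_⟩
  rwa [add_comm, ← sub_sub]

/-- Let `f` be additive of degree `N ≥ 2`, and let `θ` be the radius at which its leading term has
size `θ`. If another term is larger than `θ` on the circle of radius `θ`, then the points with
bounded orbit are contained in finitely many discs of some radius smaller than `θ`. -/
theorem IsNonarchimedean.exists_isFinitelyCovered_iterate (hν : IsNonarchimedean ν) {θ : ℝ}
    (hθ : 0 < θ) {f : E[X]} (hadd : ∀ x y, f.eval (x + y) = f.eval x + f.eval y)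
    (hN : 2 ≤ f.natDegree) (hlead : ν f.leadingCoeff * θ ^ f.natDegree = θ) {k : ℕ}
    (hk : θ < ν (f.coeff k) * θ ^ k) :
    ∃ ρ, 0 < ρ ∧ ρ < 1 ∧ ∀ S, ∃ m, IsFinitelyCovered ν (fun x => f.eval x)^[m] (ρ * θ) S := by
  have hsub : ∀ x y, f.eval (x - y) = f.eval x - f.eval y := fun x y => by
    rw [eq_sub_iff_add_eq, ← hadd, sub_add_cancel]
  obtain ⟨ρ, hρ0, hρ1, hρ⟩ : ∃ ρ : ℝ, 0 < ρ ∧ ρ < 1 ∧ θ < ν (f.coeff k) * (ρ * θ) ^ k := by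
    have hcont : Filter.Tendsto (fun ρ : ℝ => ν (f.coeff k) * (ρ * θ) ^ k)
        (nhdsWithin 1 (Set.Iio 1)) (nhds (ν (f.coeff k) * (1 * θ) ^ k)) :=
      ((by fun_prop : Continuous fun ρ : ℝ => ν (f.coeff k) * (ρ * θ) ^ k).tendsto 1).mono_left
        nhdsWithin_le_nhds
    rw [one_mul] at hcont
    obtain ⟨ρ, h1, h2⟩ := ((hcont.eventually_const_lt hk).and
      (Ioo_mem_nhdsLT (zero_lt_one' ℝ))).exists
    exact ⟨ρ, h2.1, h2.2, h1⟩
  refine ⟨ρ, hρ0, hρ1, fun S => ?_⟩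
  obtain ⟨R, hR, hRk⟩ := exists_between hρ
  -- radii `θ w ^ j` with `θ w ^ 2 = R`
  set w := Real.sqrt (R / θ) with hw
  have hRθ : 1 < R / θ := (one_lt_div hθ).2 hR
  have hw1 : 1 < w := by
    rw [hw, ← Real.sqrt_one]
    exact Real.sqrt_lt_sqrt zero_le_one hRθ
  have hw2 : θ * w ^ 2 = R := by
    rw [hw, Real.sq_sqrt (by linarith), mul_div_cancel₀ _ hθ.ne']
  have hstep : ∀ j,
      IsFinitelyCovered ν (fun x => f.eval x) (θ * w ^ (j + 2)) (θ * w ^ (j + 3)) := by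
    intro j
    refine hν.isFinitelyCovered_eval (by positivity) hadd (k := f.natDegree) ?_
    rw [coeff_natDegree, mul_pow, ← mul_assoc, hlead, ← pow_mul]
    refine mul_lt_mul_of_pos_left (pow_lt_pow_right₀ hw1 ?_) hθ
    nlinarith
  have hiter : ∀ n j, IsFinitelyCovered ν (fun x => f.eval x)^[n] (θ * w ^ (j + 2))
      (θ * w ^ (j + 2 + n)) := fun n => by
    induction n with
    | zero => exact fun j => ⟨{0}, fun x hx => ⟨0, by simp, by simpa using hx⟩⟩
    | succ n ih =>
      intro j
      have h1 := ih (j + 1)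
      rw [show j + 1 + 2 = j + 3 by ring, show j + 3 + n = j + 2 + (n + 1) by ring] at h1
      rw [Function.iterate_succ]
      exact hν.isFinitelyCovered_comp hsub (hstep j) h1
  obtain ⟨n, hn⟩ := pow_unbounded_of_one_lt (S / θ) hw1
  have hfirst : IsFinitelyCovered ν (fun x => f.eval x) (ρ * θ) (θ * w ^ (0 + 2)) :=
    hν.isFinitelyCovered_eval (by positivity) hadd (by rwa [zero_add, hw2])
  obtain ⟨c, hc⟩ := hν.isFinitelyCovered_comp hsub hfirst (hiter n 0)
  refine ⟨n + 1, c, fun x hx => hc x ?_⟩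
  rw [Function.iterate_succ] at hx
  refine hx.trans ?_
  rw [div_lt_iff₀ hθ, mul_comm] at hn
  refine hn.le.trans ?_
  have : w ^ n ≤ w ^ (0 + 2 + n) := pow_le_pow_right₀ hw1.le (by omega)
  gcongr

/-- Where the leading term dominates, it determines the absolute value. -/
theorem IsNonarchimedean.map_eval_of_dominant (hν : IsNonarchimedean ν) {f : E[X]} {y : E}
    (hf : f ≠ 0) (hy : ∀ k < f.natDegree,
      ν (f.coeff k) * ν y ^ k < ν f.leadingCoeff * ν y ^ f.natDegree) :
    ν (f.eval y) = ν f.leadingCoeff * ν y ^ f.natDegree := by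
  rw [eval_eq_sum_range, Finset.sum_range_succ, coeff_natDegree]
  have hlead : ν (f.leadingCoeff * y ^ f.natDegree) = ν f.leadingCoeff * ν y ^ f.natDegree := by
    rw [map_mul, map_pow]
  have hlt : ν (∑ k ∈ Finset.range f.natDegree, f.coeff k * y ^ k) <
      ν (f.leadingCoeff * y ^ f.natDegree) := by
    rw [hlead]
    rcases Finset.eq_empty_or_nonempty (Finset.range f.natDegree) with he | hne
    · rw [he, Finset.sum_empty, map_zero]
      rw [Finset.range_eq_empty_iff] at he
      rw [he, pow_zero, mul_one]
      exact ν.pos (leadingCoeff_ne_zero.2 hf)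
    · obtain ⟨k, hk, hle⟩ := hν.finset_image_add_of_nonempty (fun k => f.coeff k * y ^ k) hne
      refine hle.trans_lt ?_
      rw [map_mul, map_pow]
      exact hy k (Finset.mem_range.1 hk)
  rw [hν.add_eq_max_of_ne hlt.ne, max_eq_right hlt.le, hlead]

end Additive

/-! ### Absolute values on purely inseparable extensions -/

/-- A non-archimedean absolute value extends to purely inseparable extensions, through
`|x| ^ (p ^ n) = |x ^ (p ^ n)|`. -/
theorem AbsoluteValue.exists_extension_of_pow_mem {K E : Type*} [Field K] [Field E] [Algebra K E]
    (p : ℕ) [ExpChar K p] (hE : ∀ x : E, ∃ n : ℕ, x ^ p ^ n ∈ (algebraMap K E).range)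
    (ν₀ : AbsoluteValue K ℝ) (hν₀ : IsNonarchimedean ν₀) :
    ∃ ν : AbsoluteValue E ℝ, IsNonarchimedean ν ∧ ∀ x, ν (algebraMap K E x) = ν₀ x := by
  have : ExpChar E p := expChar_of_injective_algebraMap (algebraMap K E).injective p
  have hp : ∀ n, p ^ n ≠ 0 := fun n => pow_ne_zero n (expChar_pos K p).ne'
  have hex : ∀ x : E, ∃ t : ℝ, 0 ≤ t ∧
      ∀ (m : ℕ) (z : K), algebraMap K E z = x ^ p ^ m → t ^ p ^ m = ν₀ z := by
    intro x
    obtain ⟨n, y, hy⟩ := hE x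
    refine ⟨(ν₀ y) ^ ((p ^ n : ℕ) : ℝ)⁻¹, Real.rpow_nonneg (ν₀.nonneg y) _, fun m z hz => ?_⟩
    have h1 : z ^ p ^ n = y ^ p ^ m := (algebraMap K E).injective (by
      rw [map_pow, map_pow, hz, hy, ← pow_mul, ← pow_mul, mul_comm])
    have h2 : ((ν₀ y) ^ ((p ^ n : ℕ) : ℝ)⁻¹) ^ p ^ n = ν₀ y :=
      Real.rpow_inv_natCast_pow (ν₀.nonneg y) (hp n)
    refine (pow_left_inj₀ (by positivity) (ν₀.nonneg z) (hp n)).1 ?_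
    rw [← map_pow ν₀ z, h1, map_pow, ← pow_mul, mul_comm (p ^ m), pow_mul, h2]
  choose ν hν0 hν using hex
  have hcomm : ∀ x y : E, ∃ (m : ℕ) (z w : K), algebraMap K E z = x ^ p ^ m ∧
      algebraMap K E w = y ^ p ^ m := by
    intro x y
    obtain ⟨n, z, hz⟩ := hE x
    obtain ⟨n', w, hw⟩ := hE y
    refine ⟨n + n', z ^ p ^ n', w ^ p ^ n, ?_, ?_⟩
    · rw [map_pow, hz, pow_add, pow_mul]
    · rw [map_pow, hw, pow_add, mul_comm, pow_mul]
  have hmul : ∀ x y, ν (x * y) = ν x * ν y := by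
    intro x y
    obtain ⟨m, z, w, hz, hw⟩ := hcomm x y
    refine (pow_left_inj₀ (hν0 _) (mul_nonneg (hν0 x) (hν0 y)) (hp m)).1 ?_
    rw [mul_pow, hν x m z hz, hν y m w hw, hν (x * y) m (z * w) (by rw [map_mul, hz, hw, mul_pow]),
      map_mul]
  have hadd : ∀ x y, ν (x + y) ≤ max (ν x) (ν y) := by
    intro x y
    obtain ⟨m, z, w, hz, hw⟩ := hcomm x y
    refine le_of_pow_le_pow_left₀ (hp m) (le_max_of_le_left (hν0 x)) ?_
    rw [hν (x + y) m (z + w) (by rw [map_add, hz, hw, add_pow_expChar_pow])]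
    refine (hν₀ z w).trans (max_le ?_ ?_)
    · rw [← hν x m z hz]
      exact pow_le_pow_left₀ (hν0 x) (le_max_left _ _) _
    · rw [← hν y m w hw]
      exact pow_le_pow_left₀ (hν0 y) (le_max_right _ _) _
  have heq0 : ∀ x, ν x = 0 ↔ x = 0 := by
    intro x
    obtain ⟨n, z, hz⟩ := hE x
    rw [← pow_eq_zero_iff (hp n), hν x n z hz, map_eq_zero, ← map_eq_zero (algebraMap K E), hz,
      pow_eq_zero_iff (hp n)]
  exact ⟨{ toFun := ν
           map_mul' := hmul
           nonneg' := hν0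
           eq_zero' := heq0
           add_le' := fun x y => (hadd x y).trans (max_le_add_of_nonneg (hν0 x) (hν0 y)) },
    hadd, fun x => by simpa using hν (algebraMap K E x) 0 x (by simp)⟩

namespace DiscreteVal

variable {K : Type*} [Field K] (v : DiscreteVal K)

open Classical in
/-- The function `exp (- v(x))` attached to a discrete valuation. -/
def absFun (x : K) : ℝ :=
  if x = 0 then 0 else Real.exp (-(v.ord x : ℝ))

theorem absFun_of_ne {x : K} (hx : x ≠ 0) : v.absFun x = Real.exp (-(v.ord x : ℝ)) := if_neg hx

theorem absFun_nonneg (x : K) : 0 ≤ v.absFun x := by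
  unfold absFun
  split_ifs
  · exact le_rfl
  · positivity

theorem absFun_add_le (x y : K) : v.absFun (x + y) ≤ max (v.absFun x) (v.absFun y) := by
  by_cases hxy : x + y = 0
  · rw [hxy, absFun, if_pos rfl]
    exact le_max_of_le_left (v.absFun_nonneg x)
  by_cases hx : x = 0
  · rw [hx, zero_add]
    exact le_max_right _ _
  by_cases hy : y = 0
  · rw [hy, add_zero]
    exact le_max_left _ _
  rw [v.absFun_of_ne hxy, v.absFun_of_ne hx, v.absFun_of_ne hy, le_max_iff, Real.exp_le_exp,
    Real.exp_le_exp, neg_le_neg_iff, neg_le_neg_iff, Int.cast_le, Int.cast_le]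
  have hne : ∀ {z : K}, z ≠ 0 → v.1 z ≠ 0 := fun hz => (Valuation.ne_zero_iff _).2 hz
  simp only [ord, neg_le_neg_iff]
  rw [WithZero.log_le_log (hne hxy) (hne hx), WithZero.log_le_log (hne hxy) (hne hy), ← le_max_iff]
  exact v.1.map_add x y

/-- The absolute value `exp (- v(x))` of a discrete valuation. -/
def absValue : AbsoluteValue K ℝ where
  toFun := v.absFun
  map_mul' x y := by
    by_cases hx : x = 0
    · simp [hx, absFun]
    by_cases hy : y = 0
    · simp [hy, absFun]
    rw [v.absFun_of_ne hx, v.absFun_of_ne hy, v.absFun_of_ne (mul_ne_zero hx hy), v.ord_mul hx hy,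
      ← Real.exp_add]
    push_cast
    ring_nf
  nonneg' := v.absFun_nonneg
  eq_zero' x := by simp [absFun]
  add_le' x y := (v.absFun_add_le x y).trans
    (max_le_add_of_nonneg (v.absFun_nonneg x) (v.absFun_nonneg y))

theorem isNonarchimedean_absValue : IsNonarchimedean v.absValue := v.absFun_add_le

theorem log_absValue (x : K) (hx : x ≠ 0) : Real.log (v.absValue x) = -(v.ord x : ℝ) := by
  change Real.log (v.absFun x) = _
  rw [v.absFun_of_ne hx, Real.log_exp]

end DiscreteVal

/-! ### Heights for additive polynomials over fields with a product formula -/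

section GlobalHeight

open Polynomial Real

/-- A family of non-archimedean absolute values with weights, for which the product formula
holds. -/
structure ProductFormula {ι E : Type*} [Field E] (d : ι → ℝ) (ν : ι → AbsoluteValue E ℝ) :
    Prop where
  pos : ∀ i, 0 < d i
  isNonarchimedean : ∀ i, IsNonarchimedean (ν i)
  finite : ∀ x, x ≠ 0 → {i | ν i x ≠ 1}.Finite
  sum_log : ∀ x, x ≠ 0 → ∑ᶠ i, d i * log (ν i x) = 0

/-- The radius `θ` with `|a| θ ^ N = θ`, where `a X ^ N` is the leading term of `f`. A polynomial
has bad reduction at `ν` if another term `b X ^ k` of it has `|b| θ ^ k > θ`. For `N ≤ 1` the value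
is of no use. -/
def Polynomial.scaleRadius {E : Type*} [Field E] (ν : AbsoluteValue E ℝ) (f : E[X]) : ℝ :=
  exp (-log (ν f.leadingCoeff) / (f.natDegree - 1))

/-- The height of `x` with respect to the radii attached to `f`. -/
def Polynomial.height {ι E : Type*} [Field E] (d : ι → ℝ) (ν : ι → AbsoluteValue E ℝ) (f : E[X])
    (x : E) : ℝ :=
  ∑ᶠ i, d i * log⁺ (ν i x / f.scaleRadius (ν i))

theorem Polynomial.scaleRadius_pos {E : Type*} [Field E] (ν : AbsoluteValue E ℝ) (f : E[X]) :
    0 < f.scaleRadius ν := exp_pos _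

theorem Polynomial.leadingCoeff_mul_scaleRadius_pow {E : Type*} [Field E] (ν : AbsoluteValue E ℝ)
    {f : E[X]} (hf : 2 ≤ f.natDegree) :
    ν f.leadingCoeff * f.scaleRadius ν ^ f.natDegree = f.scaleRadius ν := by
  have h0 : f ≠ 0 := by
    rintro rfl
    simp at hf
  have hN : (2 : ℝ) ≤ f.natDegree := by exact_mod_cast hf
  have hN' : (f.natDegree : ℝ) - 1 ≠ 0 := by linarith
  have hpos : 0 < ν f.leadingCoeff := ν.pos (leadingCoeff_ne_zero.2 h0)
  conv_lhs => rw [← exp_log hpos]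
  rw [scaleRadius, ← exp_nat_mul, ← exp_add]
  congr 1
  field_simp
  ring

/-- Iterates of a point at which the leading term dominates. -/
theorem IsNonarchimedean.map_iterate_of_dominant {E : Type*} [Field E] {ν : AbsoluteValue E ℝ}
    (hν : IsNonarchimedean ν) {f : E[X]} (hf : 2 ≤ f.natDegree) {B : ℝ} (hB : f.scaleRadius ν ≤ B)
    (hdom : ∀ y, B < ν y → ∀ k < f.natDegree,
      ν (f.coeff k) * ν y ^ k < ν f.leadingCoeff * ν y ^ f.natDegree)
    {y : E} (hy : B < ν y) (n : ℕ) :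
    ν ((fun x => f.eval x)^[n] y) / f.scaleRadius ν =
      (ν y / f.scaleRadius ν) ^ f.natDegree ^ n := by
  have hθ := f.scaleRadius_pos ν
  have h0 : f ≠ 0 := by
    rintro rfl
    simp at hf
  have hstep : ∀ y, B < ν y →
      ν (f.eval y) / f.scaleRadius ν = (ν y / f.scaleRadius ν) ^ f.natDegree := fun y hy => by
    rw [hν.map_eval_of_dominant h0 (hdom y hy), div_pow, eq_div_iff (by positivity),
      div_mul_eq_mul_div, mul_right_comm, leadingCoeff_mul_scaleRadius_pow ν hf,
      mul_div_cancel_left₀ _ hθ.ne']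
  induction n generalizing y with
  | zero => simp
  | succ n ih =>
    have h1 : B < ν (f.eval y) := by
      have h2 := hstep y hy
      have h3 : 1 < ν y / f.scaleRadius ν := (one_lt_div hθ).2 (hB.trans_lt hy)
      have h4 : ν y / f.scaleRadius ν ≤ (ν y / f.scaleRadius ν) ^ f.natDegree :=
        le_self_pow₀ h3.le (by omega)
      rw [← h2, div_le_div_iff_of_pos_right hθ] at h4
      exact hy.trans_le h4
    rw [Function.iterate_succ_apply, ih h1, hstep y hy, ← pow_mul, ← pow_succ']

/-- The leading term dominates near infinity. -/
theorem Polynomial.exists_dominant {E : Type*} [Field E] (ν : AbsoluteValue E ℝ)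
    {f : E[X]} (hf : f ≠ 0) (b : ℝ) : ∃ B, b ≤ B ∧ ∀ y, B < ν y → ∀ k < f.natDegree,
      ν (f.coeff k) * ν y ^ k < ν f.leadingCoeff * ν y ^ f.natDegree := by
  have hpos : 0 < ν f.leadingCoeff := ν.pos (leadingCoeff_ne_zero.2 hf)
  refine ⟨max b (1 + ∑ k ∈ Finset.range f.natDegree, ν (f.coeff k) / ν f.leadingCoeff),
    le_max_left _ _, fun y hy k hk => ?_⟩
  have h1 := (le_max_right _ _).trans_lt hy
  have h2 : ν (f.coeff k) / ν f.leadingCoeff ≤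
      ∑ k ∈ Finset.range f.natDegree, ν (f.coeff k) / ν f.leadingCoeff :=
    Finset.single_le_sum (f := fun k => ν (f.coeff k) / ν f.leadingCoeff)
      (fun k _ => by positivity) (Finset.mem_range.2 hk)
  have h3 : 0 ≤ ν (f.coeff k) / ν f.leadingCoeff := by positivity
  have h4 : ν (f.coeff k) < ν y * ν f.leadingCoeff := (div_lt_iff₀ hpos).1 (by linarith)
  have h5 : (1 : ℝ) ≤ ν y := by linarith
  calc ν (f.coeff k) * ν y ^ k < ν y * ν f.leadingCoeff * ν y ^ k :=
        mul_lt_mul_of_pos_right h4 (by positivity)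
    _ = ν f.leadingCoeff * ν y ^ (k + 1) := by ring
    _ ≤ _ := by gcongr; omega

namespace ProductFormula

variable {ι E : Type*} [Field E] {d : ι → ℝ} {ν : ι → AbsoluteValue E ℝ}

theorem finite_support_log (H : ProductFormula d ν) {x : E} (hx : x ≠ 0) :
    (Function.support fun i => d i * log (ν i x)).Finite :=
  (H.finite x hx).subset fun i hi h => hi (by simp [h])

theorem finite_scaleRadius (H : ProductFormula d ν) {f : E[X]} (hf : f ≠ 0) :
    {i | f.scaleRadius (ν i) ≠ 1}.Finite :=
  (H.finite _ (leadingCoeff_ne_zero.2 hf)).subset fun i hi h => hi (by simp [scaleRadius, h])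

theorem finite_support_height (H : ProductFormula d ν) {f : E[X]} (hf : f ≠ 0) (x : E) :
    (Function.support fun i => d i * log⁺ (ν i x / f.scaleRadius (ν i))).Finite := by
  by_cases hx : x = 0
  · simp [hx]
  refine ((H.finite x hx).union (H.finite_scaleRadius hf)).subset fun i hi => ?_
  by_contra hcon
  simp only [Set.mem_union, Set.mem_ofPred_eq, not_or, not_not] at hcon
  exact hi (by simp [hcon.1, hcon.2])

theorem height_nonneg (H : ProductFormula d ν) (f : E[X]) (x : E) : 0 ≤ f.height d ν x :=
  finsum_nonneg fun i => mul_nonneg (H.pos i).le posLog_nonneg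

theorem height_neg (f : E[X]) (x : E) : f.height d ν (-x) = f.height d ν x := by
  simp [height]

theorem height_add_le (H : ProductFormula d ν) {f : E[X]} (hf : f ≠ 0) (x y : E) :
    f.height d ν (x + y) ≤ f.height d ν x + f.height d ν y := by
  rw [height, height, height,
    ← finsum_add_distrib (H.finite_support_height hf x) (H.finite_support_height hf y)]
  refine finsum_le_finsum' (H.finite_support_height hf _)
    (((H.finite_support_height hf x).union (H.finite_support_height hf y)).subset
      (Function.support_add _ _)) fun i => ?_
  rw [← mul_add]
  refine mul_le_mul_of_nonneg_left ?_ (H.pos i).le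
  have hθ := f.scaleRadius_pos (ν i)
  have hmono : ∀ a b, ν i a ≤ ν i b →
      log⁺ (ν i a / f.scaleRadius (ν i)) ≤ log⁺ (ν i b / f.scaleRadius (ν i)) := fun a b h =>
    posLog_le_posLog (by positivity) (by gcongr)
  rcases le_max_iff.1 (H.isNonarchimedean i x y) with h | h
  · exact (hmono _ _ h).trans (le_add_of_nonneg_right posLog_nonneg)
  · exact (hmono _ _ h).trans (le_add_of_nonneg_left posLog_nonneg)

/-- A polynomial multiplies heights by at most its degree, up to a bounded error. -/
theorem exists_height_eval_le (H : ProductFormula d ν) {f : E[X]} (hf : f ≠ 0) :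
    ∃ D, 0 ≤ D ∧ ∀ x, f.height d ν (f.eval x) ≤ f.natDegree * f.height d ν x + D := by
  let c : ι → ℝ := fun i => d i * ∑ k ∈ Finset.range (f.natDegree + 1),
    log⁺ (ν i (f.coeff k) * f.scaleRadius (ν i) ^ k / f.scaleRadius (ν i))
  have hc : (Function.support c).Finite := by
    have h1 : (⋃ k ∈ Finset.range (f.natDegree + 1),
        {i | f.coeff k ≠ 0 ∧ ν i (f.coeff k) ≠ 1}).Finite :=
      Set.Finite.biUnion (Finset.finite_toSet _) fun k _ => by
        by_cases hk : f.coeff k = 0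
        · simp [hk]
        · exact (H.finite _ hk).subset fun i hi => hi.2
    refine (h1.union (H.finite_scaleRadius hf)).subset fun i hi => ?_
    by_contra hcon
    simp only [Set.mem_union, Set.mem_iUnion, Set.mem_ofPred_eq, not_or, not_not, not_exists,
      not_and] at hcon
    refine hi ?_
    simp only [c]
    rw [Finset.sum_eq_zero, mul_zero]
    intro k hk
    rw [hcon.2]
    by_cases hk0 : f.coeff k = 0
    · simp [hk0]
    · simp [hcon.1 k hk hk0]
  refine ⟨∑ᶠ i, c i, finsum_nonneg fun i =>
    mul_nonneg (H.pos i).le (Finset.sum_nonneg fun k _ => posLog_nonneg), fun x => ?_⟩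
  have hsx := H.finite_support_height hf x
  rw [height, height, mul_finsum,
    ← finsum_add_distrib (hsx.subset fun i hi h => hi (by simp only [h, mul_zero])) hc]
  refine finsum_le_finsum' (H.finite_support_height hf _)
    ((hsx.union hc).subset fun i hi => ?_) fun i => ?_
  · by_contra hcon
    simp only [Set.mem_union, Function.mem_support, not_or, not_not] at hcon
    exact hi (by simp only [hcon.1, hcon.2, mul_zero, add_zero])
  have hθ := f.scaleRadius_pos (ν i)
  rw [eval_eq_sum_range]
  obtain ⟨k, hk, hle⟩ := (H.isNonarchimedean i).finset_image_add_of_nonempty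
    (fun k => f.coeff k * x ^ k) (t := Finset.range (f.natDegree + 1)) ⟨0, by simp⟩
  have hkN : k ≤ f.natDegree := Nat.lt_succ_iff.1 (Finset.mem_range.1 hk)
  set θ := f.scaleRadius (ν i)
  have h1 : log⁺ (ν i (∑ k ∈ Finset.range (f.natDegree + 1), f.coeff k * x ^ k) / θ) ≤
      log⁺ (ν i (f.coeff k) * θ ^ k / θ) + f.natDegree * log⁺ (ν i x / θ) := by
    calc _ ≤ log⁺ ((ν i (f.coeff k) * θ ^ k / θ) * (ν i x / θ) ^ k) := by
          refine posLog_le_posLog (by positivity) ?_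
          rw [map_mul, map_pow] at hle
          rw [div_pow, div_mul_div_comm, mul_right_comm, mul_div_mul_right _ _ (by positivity)]
          gcongr
      _ ≤ log⁺ (ν i (f.coeff k) * θ ^ k / θ) + log⁺ ((ν i x / θ) ^ k) := posLog_mul
      _ ≤ _ := by
          rw [posLog_pow]
          gcongr
          exact posLog_nonneg
  have h2 := Finset.single_le_sum (f := fun k => log⁺ (ν i (f.coeff k) * θ ^ k / θ))
    (fun k _ => posLog_nonneg) hk
  calc _ ≤ d i * (∑ k ∈ Finset.range (f.natDegree + 1), log⁺ (ν i (f.coeff k) * θ ^ k / θ) +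
        f.natDegree * log⁺ (ν i x / θ)) :=
        mul_le_mul_of_nonneg_left (h1.trans (by linarith)) (H.pos i).le
    _ = _ := by
        simp only [c]
        ring

theorem le_of_forall_mul_pow_le {a b D N : ℝ} (hN : 2 ≤ N)
    (h : ∀ n : ℕ, a * N ^ n ≤ b * N ^ n + D) : a ≤ b := by
  by_contra! hab
  obtain ⟨n, hn⟩ := pow_unbounded_of_one_lt (D / (a - b)) (by linarith : 1 < N)
  rw [div_lt_iff₀ (by linarith)] at hn
  nlinarith [h n]

theorem mul_posLog_le_height (H : ProductFormula d ν) {f : E[X]} (hf : f ≠ 0) (x : E) (i : ι) :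
    d i * log⁺ (ν i x / f.scaleRadius (ν i)) ≤ f.height d ν x :=
  single_le_finsum i (H.finite_support_height hf x) fun j =>
    mul_nonneg (H.pos j).le posLog_nonneg

/-- By the product formula for `x` and for the leading coefficient of `f`, the height can be
computed from the places where `x` is small. -/
theorem mul_posLog_inv_le_height (H : ProductFormula d ν) {f : E[X]} (hf : f ≠ 0) {x : E}
    (hx : x ≠ 0) (i : ι) :
    d i * log⁺ (ν i x / f.scaleRadius (ν i))⁻¹ ≤ f.height d ν x := by
  have hl := H.finite_support_log hx
  have hl' := H.finite_support_log (leadingCoeff_ne_zero.2 hf)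
  have hs := H.finite_support_height hf x
  have hlog : ∀ i, log⁺ (ν i x / f.scaleRadius (ν i))⁻¹ = log⁺ (ν i x / f.scaleRadius (ν i)) -
      (log (ν i x) + log (ν i f.leadingCoeff) / (f.natDegree - 1)) := fun i => by
    have h1 := posLog_sub_posLog_inv (x := ν i x / f.scaleRadius (ν i))
    rw [log_div ((ν i).ne_zero hx) (f.scaleRadius_pos (ν i)).ne', scaleRadius, log_exp, neg_div,
      sub_neg_eq_add] at h1
    rw [← h1]
    simp only [scaleRadius, neg_div]
    ring
  have hfun : (fun i => d i * log⁺ (ν i x / f.scaleRadius (ν i))⁻¹) = fun i =>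
      d i * log⁺ (ν i x / f.scaleRadius (ν i)) - (d i * log (ν i x) +
        d i * log (ν i f.leadingCoeff) * (f.natDegree - 1 : ℝ)⁻¹) := by
    funext i
    rw [hlog]
    ring
  have hl'' : (Function.support fun i =>
      d i * log (ν i f.leadingCoeff) * (f.natDegree - 1 : ℝ)⁻¹).Finite :=
    hl'.subset fun i hi h => hi (by simp only [h, zero_mul])
  have hl3 : (Function.support fun i => d i * log (ν i x) +
      d i * log (ν i f.leadingCoeff) * (f.natDegree - 1 : ℝ)⁻¹).Finite :=
    (hl.union hl'').subset (Function.support_add _ _)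
  have hsum : ∑ᶠ i, d i * log⁺ (ν i x / f.scaleRadius (ν i))⁻¹ = f.height d ν x := by
    rw [hfun, finsum_sub_distrib hs hl3, finsum_add_distrib hl hl'', ← finsum_mul,
      H.sum_log x hx, H.sum_log _ (leadingCoeff_ne_zero.2 hf), zero_mul, add_zero, sub_zero, height]
  rw [← hsum]
  refine single_le_finsum (f := fun i => d i * log⁺ (ν i x / f.scaleRadius (ν i))⁻¹) i ?_
    fun j => mul_nonneg (H.pos j).le posLog_nonneg
  rw [hfun]
  exact (hs.union hl3).subset (Function.support_sub _ _)

/-- The height of a point that has size at most `θ` at all places of bad reduction grows at least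
by the factor `deg f` at each step of the iteration, because at the places of good reduction the
leading term dominates as soon as `|y| > θ`. -/
theorem height_iterate_ge (H : ProductFormula d ν) {f : E[X]} (hf : 2 ≤ f.natDegree) {y : E}
    (hy : ∀ i k, f.scaleRadius (ν i) < ν i (f.coeff k) * f.scaleRadius (ν i) ^ k →
      ν i y ≤ f.scaleRadius (ν i)) (n : ℕ) :
    f.height d ν y * f.natDegree ^ n ≤ f.height d ν ((fun x => f.eval x)^[n] y) := by
  have h0 : f ≠ 0 := by
    rintro rfl
    simp at hf
  have hs := H.finite_support_height h0 y
  rw [height, height, finsum_mul]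
  refine finsum_le_finsum' (hs.subset fun i hi h => hi (by simp only [h, zero_mul]))
    (H.finite_support_height h0 _) fun i => ?_
  rw [mul_assoc]
  refine mul_le_mul_of_nonneg_left ?_ (H.pos i).le
  have hθ := f.scaleRadius_pos (ν i)
  rcases le_or_gt (ν i y) (f.scaleRadius (ν i)) with hle | hlt
  · have hle' : |ν i y / f.scaleRadius (ν i)| ≤ 1 := by
      rw [abs_of_nonneg (by positivity)]
      exact (div_le_one hθ).2 hle
    rw [(posLog_eq_zero_iff _).2 hle', zero_mul]
    exact posLog_nonneg
  · have hgood : ∀ k, ν i (f.coeff k) * f.scaleRadius (ν i) ^ k ≤ f.scaleRadius (ν i) := fun k => by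
      by_contra! hk
      exact absurd (hy i k hk) (not_le.2 hlt)
    rw [(H.isNonarchimedean i).map_iterate_of_dominant hf le_rfl ?_ hlt n, posLog_pow, mul_comm]
    · push_cast
      exact le_rfl
    · intro z hz k hk
      set θ := f.scaleRadius (ν i)
      have h1 : 1 < ν i z / θ := (one_lt_div hθ).2 hz
      calc ν i (f.coeff k) * ν i z ^ k = ν i (f.coeff k) * θ ^ k * (ν i z / θ) ^ k := by
            rw [div_pow]
            field_simp
        _ ≤ θ * (ν i z / θ) ^ k := by gcongr; exact hgood k
        _ < θ * (ν i z / θ) ^ f.natDegree :=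
            mul_lt_mul_of_pos_left (pow_lt_pow_right₀ h1 hk) hθ
        _ = ν i f.leadingCoeff * θ ^ f.natDegree * (ν i z / θ) ^ f.natDegree := by
            rw [leadingCoeff_mul_scaleRadius_pow (ν i) hf]
        _ = _ := by
            rw [div_pow]
            field_simp

/-- There are only finitely many places of bad reduction. -/
theorem finite_bad (H : ProductFormula d ν) {f : E[X]} (hf : f ≠ 0) :
    {i | ∃ k, f.scaleRadius (ν i) < ν i (f.coeff k) * f.scaleRadius (ν i) ^ k}.Finite := by
  have h1 : (⋃ k ∈ Finset.range (f.natDegree + 1),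
      {i | f.coeff k ≠ 0 ∧ ν i (f.coeff k) ≠ 1}).Finite :=
    Set.Finite.biUnion (Finset.finite_toSet _) fun k _ => by
      by_cases hk : f.coeff k = 0
      · simp [hk]
      · exact (H.finite _ hk).subset fun i hi => hi.2
  refine (h1.union (H.finite_scaleRadius hf)).subset ?_
  rintro i ⟨k, hk⟩
  by_contra hcon
  simp only [Set.mem_union, Set.mem_iUnion, Set.mem_ofPred_eq, not_or, not_not, not_exists,
    not_and] at hcon
  have hk0 : f.coeff k ≠ 0 := fun h => by
    rw [h, map_zero, zero_mul] at hk
    exact lt_asymm hk (f.scaleRadius_pos (ν i))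
  have hkN : k ∈ Finset.range (f.natDegree + 1) :=
    Finset.mem_range.2 (Nat.lt_succ_iff.2 (le_natDegree_of_ne_zero hk0))
  rw [hcon.2, hcon.1 k hkN hk0] at hk
  simp at hk

/-- If an additive polynomial has bad reduction somewhere, then only finitely many points have
small canonical height: among many such points two are closer than `θ` at all places of bad
reduction, and the product formula bounds the height of their difference from below. -/
theorem exists_finite_canonicalHeight_le (H : ProductFormula d ν) {f : E[X]}
    (hadd : ∀ x y, f.eval (x + y) = f.eval x + f.eval y) (hf : 2 ≤ f.natDegree)
    (hbad : ∃ i k, f.scaleRadius (ν i) < ν i (f.coeff k) * f.scaleRadius (ν i) ^ k) :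
    ∃ ε > 0, {x | ∃ D, ∀ n : ℕ, f.height d ν ((fun x => f.eval x)^[n] x) ≤
      ε * f.natDegree ^ n + D}.Finite := by
  classical
  have h0 : f ≠ 0 := by
    rintro rfl
    simp at hf
  have hN : (2 : ℝ) ≤ f.natDegree := by exact_mod_cast hf
  set bad := {i | ∃ k, f.scaleRadius (ν i) < ν i (f.coeff k) * f.scaleRadius (ν i) ^ k} with hbaddef
  have hfin : bad.Finite := H.finite_bad h0
  -- at a bad place, the points of small canonical height lie in finitely many discs of radius less
  -- than `θ`, as the other ones escape to infinity too fast
  have hloc : ∀ i ∈ bad, ∃ ρ, 0 < ρ ∧ ρ < 1 ∧ ∃ δ > 0, ∃ c : Finset E, ∀ ε < δ, ∀ x D,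
      (∀ n : ℕ, f.height d ν ((fun x => f.eval x)^[n] x) ≤ ε * f.natDegree ^ n + D) →
      ∃ y ∈ c, ν i (x - y) ≤ ρ * f.scaleRadius (ν i) := by
    rintro i ⟨k, hk⟩
    have hθ := f.scaleRadius_pos (ν i)
    obtain ⟨ρ, hρ0, hρ1, hρ⟩ := (H.isNonarchimedean i).exists_isFinitelyCovered_iterate hθ hadd hf
      (leadingCoeff_mul_scaleRadius_pow (ν i) hf) hk
    obtain ⟨B, hB, hdom⟩ := exists_dominant (ν i) h0 (exp 1 * f.scaleRadius (ν i))
    obtain ⟨m, c, hc⟩ := hρ B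
    refine ⟨ρ, hρ0, hρ1, d i / f.natDegree ^ m, div_pos (H.pos i) (by positivity), c,
      fun ε hε x D hx => hc x ?_⟩
    by_contra! hlt
    have hBθ : f.scaleRadius (ν i) ≤ B :=
      (le_mul_of_one_le_left hθ.le (one_le_exp zero_le_one)).trans hB
    have h1 : d i ≤ ε * f.natDegree ^ m := le_of_forall_mul_pow_le hN (D := D) fun n => by
      have h2 := hx (n + m)
      rw [Function.iterate_add_apply] at h2
      have h3 := H.mul_posLog_le_height h0
        ((fun x => f.eval x)^[n] ((fun x => f.eval x)^[m] x)) i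
      rw [(H.isNonarchimedean i).map_iterate_of_dominant hf hBθ hdom hlt n, posLog_pow] at h3
      have h4 : 1 ≤ log⁺ (ν i ((fun x => f.eval x)^[m] x) / f.scaleRadius (ν i)) := by
        have h5 : exp 1 ≤ ν i ((fun x => f.eval x)^[m] x) / f.scaleRadius (ν i) :=
          (le_div_iff₀ hθ).2 (hB.trans hlt.le)
        calc (1 : ℝ) = log (exp 1) := (log_exp 1).symm
          _ ≤ log (ν i ((fun x => f.eval x)^[m] x) / f.scaleRadius (ν i)) :=
            log_le_log (exp_pos 1) h5
          _ ≤ _ := le_max_right _ _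
      have h6 : d i * (f.natDegree : ℝ) ^ n ≤ d i * (((f.natDegree ^ n : ℕ) : ℝ) *
          log⁺ (ν i ((fun x => f.eval x)^[m] x) / f.scaleRadius (ν i))) := by
        push_cast
        have := H.pos i
        gcongr
        exact le_mul_of_one_le_right (by positivity) h4
      calc d i * (f.natDegree : ℝ) ^ n ≤ _ := h6.trans (h3.trans h2)
        _ = _ := by rw [pow_add]; ring
    rw [lt_div_iff₀ (by positivity)] at hε
    exact absurd h1 (not_le.2 hε)
  choose! ρ hρ0 hρ1 δ hδ c hc using hloc
  obtain ⟨i₀, k₀, hi₀⟩ := hbad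
  have hi₀' : i₀ ∈ bad := ⟨k₀, hi₀⟩
  have hlow : 0 < d i₀ * log (ρ i₀)⁻¹ :=
    mul_pos (H.pos i₀) (log_pos ((one_lt_inv₀ (hρ0 i₀ hi₀')).2 (hρ1 i₀ hi₀')))
  obtain ⟨ε, ⟨hεδ, hεlow⟩, hε0⟩ : ∃ ε : ℝ, ((∀ i ∈ bad, ε < δ i) ∧
      ε < d i₀ * log (ρ i₀)⁻¹ / 2) ∧ 0 < ε := by
    have h1 : ∀ᶠ ε in nhdsWithin (0 : ℝ) (Set.Ioi 0), ∀ i ∈ bad, ε < δ i :=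
      (Filter.eventually_all_finite hfin).2 fun i hi =>
        nhdsWithin_le_nhds (Iio_mem_nhds (hδ i hi))
    have h2 : ∀ᶠ ε in nhdsWithin (0 : ℝ) (Set.Ioi 0), ε < d i₀ * log (ρ i₀)⁻¹ / 2 :=
      nhdsWithin_le_nhds (Iio_mem_nhds (half_pos hlow))
    exact ((h1.and h2).and self_mem_nhdsWithin).exists
  refine ⟨ε, hε0, ?_⟩
  set S := {x | ∃ D, ∀ n : ℕ, f.height d ν ((fun x => f.eval x)^[n] x) ≤
      ε * f.natDegree ^ n + D} with hS
  have hcol : ∀ (x : S) (i : bad), ∃ y : c i, ν i (x - y) ≤ ρ i * f.scaleRadius (ν i) := by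
    rintro ⟨x, D, hx⟩ ⟨i, hi⟩
    obtain ⟨y, hy, hxy⟩ := hc i hi ε (hεδ i hi) x D hx
    exact ⟨⟨y, hy⟩, hxy⟩
  -- the discs around the points of `c i` colour the points of small canonical height
  choose col hcol using hcol
  have : Finite bad := hfin
  refine Set.finite_coe_iff.1 (Finite.of_injective col fun x x' hxx => ?_)
  by_contra hne
  have hy0 : (x - x' : E) ≠ 0 := sub_ne_zero.2 fun h => hne (Subtype.ext h)
  have hclose : ∀ i ∈ bad, ν i (x - x') ≤ ρ i * f.scaleRadius (ν i) := fun i hi => by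
    have h1 := hcol x ⟨i, hi⟩
    have h2 := hcol x' ⟨i, hi⟩
    rw [← hxx] at h2
    rw [← sub_sub_sub_cancel_right _ _ (col x ⟨i, hi⟩ : E)]
    exact ((H.isNonarchimedean i).map_sub_le_max _ _).trans (max_le h1 h2)
  have hθ := f.scaleRadius_pos (ν i₀)
  have hsub : ∀ (n : ℕ) (x y : E), (fun x => f.eval x)^[n] (x - y) =
      (fun x => f.eval x)^[n] x - (fun x => f.eval x)^[n] y := fun n => by
    induction n with
    | zero => exact fun x y => rfl
    | succ n ih =>
      intro x y
      rw [Function.iterate_succ_apply, Function.iterate_succ_apply, Function.iterate_succ_apply,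
        ← ih]
      congr 1
      rw [eq_sub_iff_add_eq, ← hadd, sub_add_cancel]
  have h1 : f.height d ν (x - x') ≤ 2 * ε := by
    obtain ⟨D, hD⟩ := x.2
    obtain ⟨D', hD'⟩ := x'.2
    refine le_of_forall_mul_pow_le hN (D := D + D') fun n => ?_
    have h2 := H.height_iterate_ge hf (y := x - x') (fun i k hk =>
      (hclose i ⟨k, hk⟩).trans (mul_le_of_le_one_left (f.scaleRadius_pos (ν i)).le
        (hρ1 i ⟨k, hk⟩).le)) n
    rw [hsub, sub_eq_add_neg ((fun x => f.eval x)^[n] (x : E))] at h2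
    have h3 := H.height_add_le h0 ((fun x => f.eval x)^[n] (x : E))
      (-(fun x => f.eval x)^[n] (x' : E))
    rw [height_neg] at h3
    linarith [hD n, hD' n]
  have h2 := H.mul_posLog_inv_le_height h0 hy0 i₀
  have h3 : log (ρ i₀)⁻¹ ≤ log⁺ (ν i₀ (x - x') / f.scaleRadius (ν i₀))⁻¹ := by
    refine le_trans (log_le_log (inv_pos.2 (hρ0 i₀ hi₀')) ?_) (le_max_right _ _)
    refine inv_anti₀ (div_pos ((ν i₀).pos hy0) hθ) ((div_le_iff₀ hθ).2 (hclose i₀ hi₀'))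
  have h4 : d i₀ * log (ρ i₀)⁻¹ ≤ d i₀ * log⁺ (ν i₀ (x - x') / f.scaleRadius (ν i₀))⁻¹ :=
    mul_le_mul_of_nonneg_left h3 (H.pos i₀).le
  linarith

end ProductFormula

end GlobalHeight

/-! ### Coefficients of twisted polynomials -/

namespace TwistedPoly

variable {Fq : Type*} [Field Fq] [Fintype Fq] {K : Type*} [CommRing K] [Algebra Fq K]

theorem ext {p p' : TwistedPoly Fq K} (h : ∀ n, p.coeff n = p'.coeff n) : p = p' :=
  SkewPolynomial.ext h

theorem coeff_add (p p' : TwistedPoly Fq K) (n : ℕ) :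
    (p + p').coeff n = p.coeff n + p'.coeff n :=
  SkewPolynomial.coeff_add p p' n

theorem coeff_sum {ι : Type*} (s : Finset ι) (p : ι → TwistedPoly Fq K) (n : ℕ) :
    (∑ i ∈ s, p i).coeff n = ∑ i ∈ s, (p i).coeff n :=
  map_sum (⟨⟨fun p => p.coeff n, rfl⟩, fun p p' => coeff_add p p' n⟩ : TwistedPoly Fq K →+ K) p s

theorem coeff_mul (p p' : TwistedPoly Fq K) (n : ℕ) :
    (p * p').coeff n = ∑ x ∈ Finset.HasAntidiagonal.antidiagonal n,
      p.coeff x.1 * p'.coeff x.2 ^ Fintype.card Fq ^ x.1 := by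
  let := frobeniusAction Fq K
  let e : ℕ × ℕ ↪ Multiplicative ℕ × Multiplicative ℕ :=
    ⟨fun x => (Multiplicative.ofAdd x.1, Multiplicative.ofAdd x.2), fun x y h => h⟩
  have h := SkewMonoidAlgebra.coeff_mul_antidiagonal_of_finset (k := K) p p'
    (Multiplicative.ofAdd n) ((Finset.HasAntidiagonal.antidiagonal n).map e) (fun {x} => by
      rw [Finset.mem_map]
      constructor
      · rintro ⟨y, hy, rfl⟩
        exact Finset.HasAntidiagonal.mem_antidiagonal.1 hy
      · exact fun hx => ⟨x, Finset.HasAntidiagonal.mem_antidiagonal.2 hx, rfl⟩)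
  rw [Finset.sum_map] at h
  refine h.trans (Finset.sum_congr rfl fun x _ => ?_)
  rw [frobeniusAction_smul (Fq := Fq)]
  rfl

theorem coeff_C (a : K) (n : ℕ) : (C Fq a).coeff n = if n = 0 then a else 0 :=
  SkewPolynomial.coeff_C

theorem coeff_C_mul (a : K) (p : TwistedPoly Fq K) (n : ℕ) :
    (C Fq a * p).coeff n = a * p.coeff n := by
  rw [coeff_mul, Finset.sum_eq_single (0, n)]
  · simp [coeff_C]
  · rintro ⟨i, j⟩ hij hne
    rw [Finset.HasAntidiagonal.mem_antidiagonal] at hij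
    simp only at hij
    have : i ≠ 0 := fun h => hne (by subst h; simp_all)
    simp [coeff_C, this]
  · intro h
    simp at h

theorem coeff_mul_C (p : TwistedPoly Fq K) (a : K) (n : ℕ) :
    (p * C Fq a).coeff n = p.coeff n * a ^ Fintype.card Fq ^ n := by
  rw [coeff_mul, Finset.sum_eq_single (n, 0)]
  · simp [coeff_C]
  · rintro ⟨i, j⟩ hij hne
    rw [Finset.HasAntidiagonal.mem_antidiagonal] at hij
    simp only at hij
    have : j ≠ 0 := fun h => hne (by subst h; simp_all)
    simp [coeff_C, this, Fintype.card_ne_zero]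
  · intro h
    simp at h

theorem C_mul_tau_pow (a : K) (n : ℕ) : (C Fq a * tau Fq K ^ n : TwistedPoly Fq K) =
    (SkewMonoidAlgebra.single (Multiplicative.ofAdd n) a : SkewMonoidAlgebra K _) := by
  let := frobeniusAction Fq K
  exact SkewPolynomial.C_mul_X_pow_eq_monomial (a := a) (n := n)

theorem coeff_C_mul_tau_pow (a : K) (m n : ℕ) :
    (C Fq a * tau Fq K ^ m).coeff n = if m = n then a else 0 := by
  rw [C_mul_tau_pow]
  exact SkewPolynomial.coeff_monomial

theorem exists_coeff_eq_zero (p : TwistedPoly Fq K) : ∃ m, ∀ n, m < n → p.coeff n = 0 := by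
  refine ⟨(SkewPolynomial.support p).sup id, fun n hn => ?_⟩
  by_contra h
  exact absurd (Finset.le_sup (f := id) ((SkewPolynomial.mem_support_iff (p := p)).2 h))
    (not_le.2 hn)

theorem eq_sum {p : TwistedPoly Fq K} {m : ℕ} (h : ∀ n, m < n → p.coeff n = 0) :
    p = ∑ n ∈ Finset.range (m + 1), C Fq (p.coeff n) * tau Fq K ^ n := by
  refine ext fun n => ?_
  rw [coeff_sum]
  simp only [coeff_C_mul_tau_pow]
  rw [Finset.sum_ite_eq']
  split_ifs with hn
  · rfl
  · exact h n (by simpa using hn)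

section

variable {L : Type*} [CommRing L] [Algebra Fq L] [Algebra K L]

theorem mapAlg_C_mul_tau_pow (a : K) (n : ℕ) :
    mapAlg Fq K L (C Fq a * tau Fq K ^ n) = C Fq (algebraMap K L a) * tau Fq L ^ n := by
  let := frobeniusAction Fq K
  rw [C_mul_tau_pow]
  exact SkewMonoidAlgebra.liftNC_single _ _ _ _

theorem coeff_mapAlg (p : TwistedPoly Fq K) (n : ℕ) :
    (mapAlg Fq K L p).coeff n = algebraMap K L (p.coeff n) := by
  obtain ⟨m, hm⟩ := p.exists_coeff_eq_zero
  conv_lhs => rw [eq_sum hm, map_sum, coeff_sum]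
  simp only [mapAlg_C_mul_tau_pow, coeff_C_mul_tau_pow]
  rw [Finset.sum_ite_eq']
  split_ifs with hn
  · rfl
  · rw [hm n (by simpa using hn), map_zero]

theorem evalHom_C_mul_tau_pow (a : K) (n : ℕ) (x : L) :
    evalHom Fq K L (C Fq a * tau Fq K ^ n) x = algebraMap K L a * x ^ Fintype.card Fq ^ n := by
  let := frobeniusAction Fq K
  have h2 : evalHom Fq K L (C Fq a * tau Fq K ^ n) =
      Module.toAddMonoidEnd K L a * frobeniusEnd Fq L ^ n := by
    rw [C_mul_tau_pow]
    exact SkewMonoidAlgebra.liftNC_single _ _ _ _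
  rw [h2, ← frobeniusEnd_pow_apply, ← Algebra.smul_def]
  rfl

open Polynomial in
variable (L) in
/-- The additive polynomial `∑ aₙ X ^ (q ^ n)` of a twisted polynomial `∑ aₙ τⁿ` of degree at
most `m`. -/
def toPolynomial (p : TwistedPoly Fq K) (m : ℕ) : L[X] :=
  ∑ n ∈ Finset.range (m + 1),
    Polynomial.C (algebraMap K L (p.coeff n)) * X ^ Fintype.card Fq ^ n

theorem eval_toPolynomial {p : TwistedPoly Fq K} {m : ℕ} (h : ∀ n, m < n → p.coeff n = 0) (x : L) :
    (p.toPolynomial L m).eval x = evalHom Fq K L p x := by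
  conv_rhs => rw [eq_sum h, map_sum]
  refine Eq.trans ?_ (AddMonoidHom.finsetSum_apply _ _ _).symm
  rw [toPolynomial, Polynomial.eval_finsetSum]
  refine Finset.sum_congr rfl fun n _ => Eq.trans ?_ (evalHom_C_mul_tau_pow _ _ _).symm
  simp

omit [Algebra Fq L] in
theorem coeff_toPolynomial {p : TwistedPoly Fq K} {m : ℕ} (h : ∀ n, m < n → p.coeff n = 0) (n : ℕ) :
    (p.toPolynomial L m).coeff (Fintype.card Fq ^ n) = algebraMap K L (p.coeff n) := by
  have hq : 1 < Fintype.card Fq := Fintype.one_lt_card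
  rw [toPolynomial, Polynomial.finsetSum_coeff]
  simp only [Polynomial.coeff_C_mul_X_pow, (Nat.pow_right_injective hq).eq_iff]
  rw [Finset.sum_ite_eq]
  split_ifs with hn
  · rfl
  · rw [h n (by simpa using hn), map_zero]

omit [Algebra Fq L] in
theorem natDegree_toPolynomial [Nontrivial L] {p : TwistedPoly Fq K} {m : ℕ}
    (h : ∀ n, m < n → p.coeff n = 0) (hm : algebraMap K L (p.coeff m) ≠ 0) :
    (p.toPolynomial L m).natDegree = Fintype.card Fq ^ m := by
  refine le_antisymm ?_ (Polynomial.le_natDegree_of_ne_zero (by rwa [coeff_toPolynomial h]))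
  refine Polynomial.natDegree_sum_le_of_forall_le _ _ fun n hn => ?_
  refine (Polynomial.natDegree_C_mul_X_pow_le _ _).trans ?_
  exact Nat.pow_le_pow_right Fintype.card_pos (Nat.lt_succ_iff.1 (Finset.mem_range.1 hn))

end

/-- If a twisted polynomial commutes with a monic one of positive degree `m` whose coefficients are
algebraic over `k`, then its coefficients are algebraic over `k` too: from the top down, they
satisfy equations `c ^ (q ^ m) - c = b` with `b` algebraic over `k`. -/
theorem coeff_mem_of_commute {k L : Type*} [Field k] [Field L] [Algebra Fq L] [Algebra k L]
    {g h : TwistedPoly Fq L} (hgh : g * h = h * g) {m : ℕ} (hm : 0 < m) (hg : g.coeff m = 1)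
    (hgm : ∀ n, m < n → g.coeff n = 0) (hgk : ∀ n, g.coeff n ∈ algebraicClosure k L) (n : ℕ) :
    h.coeff n ∈ algebraicClosure k L := by
  obtain ⟨l, hl⟩ := h.exists_coeff_eq_zero
  induction hd : l + 1 - n using Nat.strong_induction_on generalizing n with
  | _ d ih =>
  by_cases hn : l < n
  · rw [hl n hn]
    exact zero_mem _
  have hlow : ∀ j, n < j → h.coeff j ∈ algebraicClosure k L := fun j hj =>
    ih (l + 1 - j) (by omega) j rfl
  have hc := congrArg (fun p => p.coeff (m + n)) hgh
  simp only [coeff_mul] at hc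
  have hmem₁ : (m, n) ∈ Finset.HasAntidiagonal.antidiagonal (m + n) := by simp
  have hmem₂ : (n, m) ∈ Finset.HasAntidiagonal.antidiagonal (m + n) := by simp [add_comm]
  rw [← Finset.add_sum_erase _ _ hmem₁, ← Finset.add_sum_erase _ _ hmem₂] at hc
  simp only [hg, one_pow, one_mul, mul_one] at hc
  set s₁ := ∑ x ∈ (Finset.HasAntidiagonal.antidiagonal (m + n)).erase (m, n),
    g.coeff x.1 * h.coeff x.2 ^ Fintype.card Fq ^ x.1 with hs₁
  set s₂ := ∑ x ∈ (Finset.HasAntidiagonal.antidiagonal (m + n)).erase (n, m),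
    h.coeff x.1 * g.coeff x.2 ^ Fintype.card Fq ^ x.1 with hs₂
  have h₁ : s₁ ∈ algebraicClosure k L := by
    refine sum_mem fun x hx => ?_
    obtain ⟨hne, hx⟩ := Finset.mem_erase.1 hx
    rw [Finset.HasAntidiagonal.mem_antidiagonal] at hx
    by_cases hx1 : m < x.1
    · rw [hgm _ hx1, zero_mul]
      exact zero_mem _
    · refine mul_mem (hgk _) (pow_mem (hlow _ ?_) _)
      by_contra hcon
      exact hne (Prod.ext (by simp only; omega) (by simp only; omega))
  have h₂ : s₂ ∈ algebraicClosure k L := by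
    refine sum_mem fun x hx => ?_
    obtain ⟨hne, hx⟩ := Finset.mem_erase.1 hx
    rw [Finset.HasAntidiagonal.mem_antidiagonal] at hx
    by_cases hx1 : m < x.2
    · rw [hgm _ hx1, zero_pow (pow_ne_zero _ Fintype.card_ne_zero), mul_zero]
      exact zero_mem _
    · refine mul_mem (hlow _ ?_) (pow_mem (hgk _) _)
      by_contra hcon
      exact hne (Prod.ext (by simp only; omega) (by simp only; omega))
  have hq : 1 < Fintype.card Fq ^ m := Nat.one_lt_pow hm.ne' Fintype.one_lt_card
  have halg : IsAlgebraic k (Polynomial.aeval (h.coeff n)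
      (Polynomial.X ^ Fintype.card Fq ^ m - Polynomial.X : Polynomial k)) := by
    rw [← mem_algebraicClosure_iff]
    have : Polynomial.aeval (h.coeff n)
      (Polynomial.X ^ Fintype.card Fq ^ m - Polynomial.X : Polynomial k) = s₂ - s₁ := by
      simp only [map_sub, map_pow, Polynomial.aeval_X]
      linear_combination hc
    rw [this]
    exact sub_mem h₂ h₁
  rw [mem_algebraicClosure_iff]
  have hdeg : (Polynomial.X ^ Fintype.card Fq ^ m - Polynomial.X : Polynomial k).natDegree =
      Fintype.card Fq ^ m := FiniteField.X_pow_card_sub_X_natDegree_eq k hq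
  refine halg.of_aeval _ (by omega) ?_
  refine mem_nonZeroDivisors_of_ne_zero (Polynomial.leadingCoeff_ne_zero.2 fun h0 => ?_)
  rw [h0, Polynomial.natDegree_zero] at hdeg
  omega

end TwistedPoly

/-! ### The isotriviality criterion -/

namespace DrinfeldModule

variable {Fq A K : Type*} [Field Fq] [Fintype Fq] [CommRing A] [Field K] [Algebra Fq K]
  {i : A →+* K}

theorem coeff_conj (φ : DrinfeldModule Fq i) {L : Type*} [Field L] [Algebra Fq L] [Algebra K L]
    (γ : Lˣ) (a : A) (n : ℕ) : (φ.conj γ a).coeff n =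
      (↑γ⁻¹ : L) * algebraMap K L ((φ.toRingHom a).coeff n) * (γ : L) ^ Fintype.card Fq ^ n := by
  change (TwistedPoly.C Fq (↑γ⁻¹ : L) * TwistedPoly.mapAlg Fq K L (φ.toRingHom a) *
    TwistedPoly.C Fq (γ : L)).coeff n = _
  rw [TwistedPoly.coeff_mul_C, TwistedPoly.coeff_C_mul, TwistedPoly.coeff_mapAlg]

/-- If `φ` has positive relative modular transcendence degree over `K₀`, then one of the invariants
`aₙ ^ (q ^ m - 1) / aₘ ^ (q ^ n - 1)` of the twisted polynomial `φ_t = ∑ aₙ τⁿ` of degree `m` is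
not in `K₀`. Otherwise a conjugate of `φ_t` is monic with coefficients algebraic over `K₀`; as `A`
is commutative, this passes to the whole conjugate of `φ`. -/
theorem exists_invariant_notMem (φ : DrinfeldModule Fq i) (K₀ : Subfield K)
    (hφ : 0 < φ.relModularTrdeg K₀) {t : A} {m : ℕ} (hm : 0 < m)
    (hlead : (φ.toRingHom t).coeff m ≠ 0) (htop : ∀ n, m < n → (φ.toRingHom t).coeff n = 0) :
    ∃ n, (φ.toRingHom t).coeff n ^ (Fintype.card Fq ^ m - 1) /
      (φ.toRingHom t).coeff m ^ (Fintype.card Fq ^ n - 1) ∉ K₀ := by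
  by_contra! hall
  have hq : 1 < Fintype.card Fq ^ m := Nat.one_lt_pow hm.ne' Fintype.one_lt_card
  let L := AlgebraicClosure K
  set b : L := algebraMap K L ((φ.toRingHom t).coeff m) with hb
  have hb0 : b ≠ 0 := by simpa [hb] using hlead
  -- conjugation by a `(q ^ m - 1)`-th root `c` of `b⁻¹` makes `φ_t` monic
  obtain ⟨c, hc⟩ := IsAlgClosed.exists_pow_nat_eq b⁻¹ (n := Fintype.card Fq ^ m - 1) (by omega)
  have hc0 : c ≠ 0 := by
    rintro rfl
    rw [zero_pow (by omega), eq_comm, inv_eq_zero] at hc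
    exact hb0 hc
  let γ : Lˣ := Units.mk0 c hc0
  have hcoeff : ∀ n, (φ.conj γ t).coeff n =
      algebraMap K L ((φ.toRingHom t).coeff n) * c ^ (Fintype.card Fq ^ n - 1) := fun n => by
    have hpos : 0 < Fintype.card Fq ^ n := pow_pos Fintype.card_pos n
    rw [coeff_conj]
    change c⁻¹ * _ * c ^ _ = _
    obtain ⟨l, hl⟩ := Nat.exists_eq_succ_of_ne_zero hpos.ne'
    rw [hl, Nat.succ_sub_one, pow_succ]
    linear_combination (algebraMap K L ((φ.toRingHom t).coeff n) * c ^ l) * inv_mul_cancel₀ hc0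
  have halg : ∀ n, (φ.conj γ t).coeff n ∈ algebraicClosure K₀ L := fun n => by
    rw [mem_algebraicClosure_iff]
    refine IsAlgebraic.of_pow (n := Fintype.card Fq ^ m - 1) (by omega) ?_
    have : (φ.conj γ t).coeff n ^ (Fintype.card Fq ^ m - 1) = algebraMap K₀ L ⟨_, hall n⟩ := by
      rw [hcoeff, mul_pow, ← pow_mul, mul_comm (Fintype.card Fq ^ n - 1), pow_mul, hc, inv_pow,
        IsScalarTower.algebraMap_apply K₀ K L]
      change _ = algebraMap K L (_ / _)
      rw [map_div₀, map_pow, map_pow, div_eq_mul_inv]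
    rw [this]
    exact isAlgebraic_algebraMap _
  have hone : (φ.conj γ t).coeff m = 1 := by
    rw [hcoeff, hc]
    exact mul_inv_cancel₀ hb0
  have hzero : ∀ n, m < n → (φ.conj γ t).coeff n = 0 := fun n hn => by
    rw [hcoeff, htop n hn, map_zero, zero_mul]
  have hdef : TwistedPoly.fieldOfDefinition (φ.conj γ) ≤ (algebraicClosure K₀ L).toSubfield := by
    refine Subfield.closure_le.2 ?_
    rintro _ ⟨a, n, rfl⟩
    exact TwistedPoly.coeff_mem_of_commute (by rw [← map_mul, ← map_mul, mul_comm]) hm hone hzero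
      halg n
  have hadj : IntermediateField.adjoin K₀ (TwistedPoly.fieldOfDefinition (φ.conj γ) : Set L) ≤
      algebraicClosure K₀ L := IntermediateField.adjoin_le_iff.2 hdef
  have htr : Algebra.trdeg K₀ (IntermediateField.adjoin K₀
      (TwistedPoly.fieldOfDefinition (φ.conj γ) : Set L)) = 0 := by
    have : Algebra.IsAlgebraic K₀ (IntermediateField.adjoin K₀
        (TwistedPoly.fieldOfDefinition (φ.conj γ) : Set L)) :=
      ⟨fun x => IntermediateField.isAlgebraic_iff.2 (mem_algebraicClosure_iff.1 (hadj x.2))⟩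
    exact trdeg_eq_zero
  have hle : φ.relModularTrdeg K₀ ≤ 0 := htr ▸ ciInf_le' _ γ
  exact absurd hle (not_le.2 hφ)

end DrinfeldModule

/-! ### Function fields and the ring of functions regular away from a point -/

section FunctionField

open Polynomial Algebra nonZeroDivisors

/-- A function field over `k'` is algebraic over `k[t]` for every `t` that is transcendental over
a subfield `k` of `k'` over which `k'` is algebraic. -/
theorem IsCurveFunctionField.isAlgebraic_polynomial {k k' F : Type*} [Field k] [Field k']
    [Field F] [Algebra k k'] [Algebra k' F] [Algebra k F] [IsScalarTower k k' F]
    [Algebra.IsAlgebraic k k'] (hF : IsCurveFunctionField k' F) [Algebra k[X] F]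
    [IsScalarTower k k[X] F] [FaithfulSMul k[X] F] : Algebra.IsAlgebraic k[X] F := by
  have hinj : Function.Injective (algebraMap k[X] F) := FaithfulSMul.algebraMap_injective _ _
  have htr : Transcendental k (algebraMap k[X] F X) := by
    rw [transcendental_iff_injective]
    convert hinj using 1
    ext p
    conv_rhs => rw [← aeval_X_left_apply p]
    rw [← Polynomial.aeval_algebraMap_apply]
  have h1 : trdeg k F = 1 := by
    have h2 := lift_trdeg_add_eq k k' F
    have h3 : trdeg k k' = 0 := trdeg_eq_zero
    rw [h3, hF.2] at h2
    simpa using h2.symm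
  have hbasis : IsTranscendenceBasis k (fun _ : Unit => algebraMap k[X] F X) :=
    AlgebraicIndependent.isTranscendenceBasis_of_lift_trdeg_le_of_finite
      (algebraicIndependent_unique_type_iff.2 htr) (by simp [h1])
  exact (hbasis.isAlgebraic_iff (S := k[X])).2 fun _ => isAlgebraic_algebraMap _

/-- A function field over a finite extension `k'` of `k` has finite rank over `k[t]` for every `t`
that is transcendental over `k`. -/
theorem IsCurveFunctionField.rank_polynomial_lt_aleph0 {k k' F : Type*} [Field k] [Field k']
    [Field F] [Algebra k k'] [Algebra k' F] [Algebra k F] [IsScalarTower k k' F]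
    [Module.Finite k k'] (hF : IsCurveFunctionField k' F) [Algebra k[X] F]
    [IsScalarTower k k[X] F] [FaithfulSMul k[X] F] : Module.rank k[X] F < Cardinal.aleph0 := by
  have : Algebra.IsAlgebraic k[X] F := hF.isAlgebraic_polynomial
  let := FractionRing.liftAlgebra k[X] F
  have : IsScalarTower k (FractionRing k[X]) F := IsScalarTower.to₁₃₄ _ k[X] _ _
  have : Algebra.IsAlgebraic (FractionRing k[X]) F :=
    .extendScalars (IsFractionRing.injective k[X] _)
  have : EssFiniteType k' F := IntermediateField.fg_top_iff.1 hF.1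
  have : EssFiniteType k F := EssFiniteType.comp k k' F
  have : EssFiniteType (FractionRing k[X]) F := EssFiniteType.of_comp k _ _
  obtain ⟨s, hs⟩ := IntermediateField.fg_top (FractionRing k[X]) F
  have : FiniteDimensional (FractionRing k[X]) F := by
    have := IntermediateField.finiteDimensional_adjoin (K := FractionRing k[X]) (S := (s : Set F))
      fun x _ => (IsAlgebraic.isAlgebraic x).isIntegral
    rw [hs] at this
    exact Module.Finite.equiv IntermediateField.topEquiv.toLinearEquiv
  rw [← IsLocalization.rank_eq (FractionRing k[X]) k[X]⁰ le_rfl]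
  exact Module.rank_lt_aleph0 _ _

/-- A module of finite rank is, up to torsion, finitely generated. -/
theorem Module.exists_finite_saturation_span_eq_top {R M : Type*} [CommRing R] [IsDomain R]
    [AddCommGroup M] [Module R M] (h : Module.rank R M < Cardinal.aleph0) :
    ∃ s : Set M, s.Finite ∧ (Submodule.span R s).saturation = ⊤ := by
  obtain ⟨s, hs, hmax⟩ := exists_maximal_linearIndepOn R (id : M → M)
  refine ⟨s, Cardinal.lt_aleph0_iff_set_finite.1 (lt_of_le_of_lt hs.cardinal_le_rank h), ?_⟩
  refine eq_top_iff.2 fun x _ => Submodule.mem_saturation.2 ?_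
  by_cases hx : x ∈ s
  · exact ⟨1, one_ne_zero, by simpa using Submodule.subset_span hx⟩
  · simpa using hmax x hx

variable {F : Type*} [Field F]

theorem mem_regularAwayFrom_iff {P : ValuationSubring F} {x : F} :
    x ∈ regularAwayFrom P ↔ ∀ V : ValuationSubring F, V ≠ ⊤ → V ≠ P → x ∈ V := by
  simp [regularAwayFrom, Subring.mem_iInf]

/-- Valuation rings are integrally closed, hence so is an intersection of valuation rings. -/
instance isIntegrallyClosed_regularAwayFrom (P : ValuationSubring F) :
    IsIntegrallyClosed (regularAwayFrom P) := by
  let A := regularAwayFrom P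
  have hinj : Function.Injective (algebraMap A F) := Subtype.val_injective
  let g : FractionRing A →ₐ[A] F := IsFractionRing.liftAlgHom (g := Algebra.ofId A F) hinj
  refine (isIntegrallyClosed_iff (FractionRing A)).2 fun {x} hx => ?_
  have hgx : IsIntegral A (g x) := hx.map g
  have hmem : g x ∈ A := by
    refine mem_regularAwayFrom_iff.2 fun V hV hVP => ?_
    have hAV : ∀ a : A, (a : F) ∈ V := fun a => mem_regularAwayFrom_iff.1 a.2 V hV hVP
    obtain ⟨f, hf, hfx⟩ := hgx
    have hint : IsIntegral V (g x) := by
      let ι : A →+* V := (A.subtype).codRestrict V.toSubring hAV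
      refine ⟨f.map ι, hf.map ι, ?_⟩
      rw [eval₂_map]
      exact hfx
    obtain ⟨y, hy⟩ := (IsIntegrallyClosed.isIntegral_iff (R := V)).1 hint
    rw [← hy]
    exact y.2
  refine ⟨⟨g x, hmem⟩, g.toRingHom.injective ?_⟩
  exact g.commutes _

end FunctionField

/-! ### Descent to a subring over which the ring has finite rank -/

section FiniteRank

open Submodule

variable {R A M : Type*} [CommRing R] [IsDomain R] [CommRing A] [IsDomain A] [Algebra R A]
  [AddCommGroup M] [Module R M] [Module A M] [IsScalarTower R A M]

/-- A nonzero element of `A` divides a nonzero element of `R`. -/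
theorem Submodule.restrictScalars_saturation_le [Algebra.IsAlgebraic R A] (N : Submodule A M) :
    N.saturation.restrictScalars R ≤ (N.restrictScalars R).saturation := by
  intro x hx
  obtain ⟨b, hb, hbx⟩ := mem_saturation.1 ((restrictScalars_mem _ _ _).1 hx)
  obtain ⟨r, hr, c, hc⟩ := (Algebra.IsAlgebraic.isAlgebraic (R := R) b).exists_nonzero_dvd
    (mem_nonZeroDivisors_of_ne_zero hb)
  refine mem_saturation.2 ⟨r, hr, (restrictScalars_mem _ _ _).2 ?_⟩
  rw [← algebraMap_smul A r x, hc, mul_comm, mul_smul]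
  exact N.smul_mem c hbx

theorem Submodule.restrictScalars_torsion_le [Algebra.IsAlgebraic R A] :
    (torsion A M).restrictScalars R ≤ torsion R M := by
  rw [← saturation_bot, ← saturation_bot]
  exact restrictScalars_saturation_le ⊥

/-- If the module `M` has a point that is not `R`-torsion and saturations of finitely generated
`R`-submodules of `M` are finitely generated, then `A`, which embeds into `M`, is finite
over `R`. -/
theorem Module.Finite.of_fg_saturation [IsNoetherianRing R] [Algebra.IsAlgebraic R A]
    (hrank : Module.rank R A < Cardinal.aleph0)
    (hfg : ∀ N : Submodule R M, N.FG → N.saturation.FG) {x : M} (hx : x ∉ torsion R M) :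
    Module.Finite R A := by
  let ψ : A →ₗ[R] M := (LinearMap.toSpanSingleton A M x).restrictScalars R
  have hψ : ∀ a, ψ a = a • x := fun a => rfl
  have hinj : Function.Injective ψ := by
    refine (injective_iff_map_eq_zero ψ).2 fun a ha => ?_
    by_contra ha0
    refine hx (restrictScalars_torsion_le (A := A) ?_)
    rw [restrictScalars_mem, ← saturation_bot, mem_saturation]
    exact ⟨a, ha0, (mem_bot A).2 ha⟩
  obtain ⟨s, hs, hsat⟩ := Module.exists_finite_saturation_span_eq_top hrank
  have hN := hfg (span R (ψ '' s)) (fg_span (hs.image ψ))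
  have hle : ∀ a, ψ a ∈ (span R (ψ '' s)).saturation := fun a => by
    obtain ⟨r, hr, hra⟩ := mem_saturation.1 (hsat ▸ mem_top : a ∈ (span R s).saturation)
    refine mem_saturation.2 ⟨r, hr, ?_⟩
    rw [← map_smul, span_image]
    exact mem_map_of_mem hra
  have : IsNoetherian R (span R (ψ '' s)).saturation := isNoetherian_of_fg_of_noetherian _ hN
  exact Module.Finite.of_injective (ψ.codRestrict _ hle) fun a b hab =>
    hinj (congrArg Subtype.val hab)

/-- The structure of a countable module over a normal domain `A` of finite rank over `R`, from
properties of it as an `R`-module. -/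
theorem Submodule.exists_isCompl_finite_free [IsNoetherianRing R] [Ring.DimensionLEOne R]
    [IsIntegrallyClosed A] [Algebra.IsAlgebraic R A] [Countable M]
    (hrank : Module.rank R A < Cardinal.aleph0)
    (htors : (torsion R M : Set M).Finite)
    (hfg : ∀ N : Submodule R M, N.FG → N.saturation.FG)
    (htop : ∀ N : Submodule R M, N.FG → N.saturation ≠ ⊤) :
    ∃ T N : Submodule A M, IsCompl T N ∧ Finite T ∧ Module.IsTorsion A T ∧ Module.Free A N ∧
      Module.rank A N = Cardinal.aleph0 := by
  obtain ⟨x, hx⟩ : ∃ x, x ∉ torsion R M := by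
    have := htop ⊥ fg_bot
    rw [saturation_bot, ne_eq, eq_top_iff'] at this
    push Not at this
    exact this
  have : Module.Finite R A := .of_fg_saturation hrank hfg hx
  have : Algebra.IsIntegral R A := inferInstance
  have : IsNoetherianRing A := IsNoetherianRing.of_finite R A
  have : Ring.DimensionLEOne A := .of_isIntegral R A
  have : IsDedekindDomain A := { }
  have hfin : ∀ N : Submodule A M, N.FG → (N.restrictScalars R).FG := fun N hN => by
    have : Module.Finite A N := Module.Finite.iff_fg.2 hN
    have : Module.Finite R N := Module.Finite.trans A N
    exact Module.Finite.iff_fg.1 this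
  obtain ⟨N, hN, ⟨e⟩⟩ := exists_isCompl_torsion (A := A) (M := M)
    (fun N hN => by
      have h1 := hfg _ (hfin N hN)
      exact (h1.of_le N.restrictScalars_saturation_le).of_restrictScalars)
    (fun N hN h => by
      refine htop _ (hfin N hN) (eq_top_iff.2 ?_)
      have := N.restrictScalars_saturation_le (R := R)
      rwa [h, restrictScalars_top] at this)
  refine ⟨torsion A M, N, hN, ?_, ?_, .of_equiv e.symm, ?_⟩
  · exact (htors.subset (restrictScalars_torsion_le (R := R) (A := A) (M := M))).to_subtype
  · exact torsion_isTorsion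
  · simpa using e.lift_rank_eq

end FiniteRank

/-! ### Places of the perfect closure -/

section Places

open Polynomial

variable {K E : Type*} [Field K] [Field E] [Algebra K E] {U : Set (DiscreteVal K)} {d : U → ℝ}

/-- The valuations of a good set extend uniquely to purely inseparable extensions; the product
formula is inherited because it can be checked on `p ^ n`-th powers. -/
theorem IsGoodSet.exists_productFormula (hU : IsGoodSet U d) (p : ℕ) [ExpChar K p]
    (hE : ∀ x : E, ∃ n : ℕ, x ^ p ^ n ∈ (algebraMap K E).range) :
    ∃ ν : U → AbsoluteValue E ℝ, ProductFormula d ν ∧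
      ∀ v x, ν v (algebraMap K E x) = v.1.absValue x := by
  choose ν hν hext using fun v : U => AbsoluteValue.exists_extension_of_pow_mem p hE
    v.1.absValue v.1.isNonarchimedean_absValue
  have key : ∀ x : E, x ≠ 0 → ∃ y : K, y ≠ 0 ∧ ∃ n : ℕ, 0 < n ∧ ∀ v,
      Real.log (ν v x) = (n : ℝ)⁻¹ * -(v.1.ord y : ℝ) := fun x hx => by
    obtain ⟨n, y, hy⟩ := hE x
    have hy0 : y ≠ 0 := by
      rintro rfl
      rw [map_zero] at hy
      exact pow_ne_zero _ hx hy.symm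
    have hp : 0 < p ^ n := pow_pos (expChar_pos K p) n
    refine ⟨y, hy0, p ^ n, hp, fun v => ?_⟩
    have hp' : ((p ^ n : ℕ) : ℝ) ≠ 0 := by exact_mod_cast hp.ne'
    rw [← v.1.log_absValue y hy0, ← hext, hy, map_pow, Real.log_pow, inv_mul_cancel_left₀ hp']
  refine ⟨ν, ⟨hU.pos, hν, fun x hx => ?_, fun x hx => ?_⟩, hext⟩
  · obtain ⟨y, hy, n, -, h⟩ := key x hx
    refine (hU.finite y hy).subset fun v hv hv0 => hv ?_
    have h1 := h v
    rw [hv0] at h1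
    exact Real.eq_one_of_pos_of_log_eq_zero ((ν v).pos hx) (by simpa using h1)
  · obtain ⟨y, hy, n, -, h⟩ := key x hx
    have h1 : ∀ v : U, d v * Real.log (ν v x) = (-(n : ℝ)⁻¹) * (d v * (v.1.ord y : ℝ)) :=
      fun v => by rw [h v]; ring
    simp_rw [h1]
    rw [← mul_finsum, hU.sum_formula y hy, mul_zero]

/-- A nonconstant element has a pole, by the sum formula. -/
theorem IsGoodSet.exists_one_lt_absValue (hU : IsGoodSet U d) {x : K} (hx : x ∉ hU.constants) :
    ∃ v : U, 1 < v.1.absValue x := by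
  have hx' : ¬ (x = 0 ∨ ∀ v ∈ U, v.ord x = 0) := hx
  push Not at hx'
  obtain ⟨hx0, v, hv, hvx⟩ := hx'
  by_contra! hcon
  refine hvx (hU.ord_eq_zero hx0 (fun w hw => ?_) v hv)
  have h1 := Real.log_nonpos (w.absValue.nonneg x) (hcon ⟨w, hw⟩)
  rw [w.log_absValue x hx0] at h1
  exact_mod_cast neg_nonpos.1 h1

/-- The `p ^ (l + 1)`-th root of a uniformizer of `K` does not lie in `K ^ (1 / p ^ l)`. -/
theorem DiscreteVal.not_forall_pow_mem (v : DiscreteVal K) (p : ℕ) [Fact p.Prime] [CharP E p]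
    [PerfectRing E p] (l : ℕ) : ¬ ∀ x : E, x ^ p ^ l ∈ (algebraMap K E).range := by
  intro h
  obtain ⟨π, hπ⟩ := v.surjective (WithZero.exp 1)
  obtain ⟨x, hx⟩ := (bijective_iterateFrobenius E p (l + 1)).2 (algebraMap K E π)
  obtain ⟨b, hb⟩ := h x
  have hbπ : b ^ p = π := (algebraMap K E).injective (by
    rw [map_pow, hb, ← hx, iterateFrobenius_def, ← pow_mul, pow_succ])
  have h1 := congrArg WithZero.log hπ
  rw [← hbπ, map_pow, WithZero.log_pow, WithZero.log_exp, nsmul_eq_mul] at h1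
  have h2 : (p : ℤ) ∣ 1 := ⟨_, h1.symm⟩
  exact (Fact.out : p.Prime).one_lt.ne' (by exact_mod_cast Int.eq_one_of_dvd_one (by positivity) h2)

/-- A pole of the invariant `b ^ (N - 1) / a ^ (k - 1)`, where `a X ^ N` is the leading term and
`b X ^ k` another term, is a place of bad reduction. -/
theorem Polynomial.exists_bad_of_one_lt {ν : AbsoluteValue E ℝ} {f : E[X]} (hf : 2 ≤ f.natDegree)
    {k : ℕ} (hk : 1 ≤ k)
    (h : 1 < ν (f.coeff k ^ (f.natDegree - 1) / f.leadingCoeff ^ (k - 1))) :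
    f.scaleRadius ν < ν (f.coeff k) * f.scaleRadius ν ^ k := by
  have hθ := f.scaleRadius_pos ν
  have hf0 : f.leadingCoeff ≠ 0 := leadingCoeff_ne_zero.2 (by rintro rfl; simp at hf)
  have hl := ν.pos hf0
  have h1 : ν f.leadingCoeff * f.scaleRadius ν ^ (f.natDegree - 1) = 1 := by
    have := leadingCoeff_mul_scaleRadius_pow ν hf
    rw [← Nat.sub_add_cancel (by omega : 1 ≤ f.natDegree), pow_succ, ← mul_assoc] at this
    exact mul_right_cancel₀ hθ.ne' (by rw [this, one_mul])
  rw [map_div₀, map_pow, map_pow, one_lt_div (by positivity)] at h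
  by_contra! hcon
  rw [← Nat.sub_add_cancel hk, pow_succ, ← mul_assoc, mul_le_iff_le_one_left hθ,
    Nat.sub_add_cancel hk] at hcon
  refine h.not_ge ?_
  calc ν (f.coeff k) ^ (f.natDegree - 1)
      = ν (f.coeff k) ^ (f.natDegree - 1) *
        (ν f.leadingCoeff * f.scaleRadius ν ^ (f.natDegree - 1)) ^ (k - 1) := by simp [h1]
    _ = (ν (f.coeff k) * f.scaleRadius ν ^ (k - 1)) ^ (f.natDegree - 1) *
        ν f.leadingCoeff ^ (k - 1) := by ring
    _ ≤ 1 ^ (f.natDegree - 1) * ν f.leadingCoeff ^ (k - 1) := by gcongr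
    _ = ν f.leadingCoeff ^ (k - 1) := by simp

/-- The height of an additive polynomial `f` is a height for the module structure over
`𝔽_p[X]` in which `X` acts through `f`. -/
theorem ProductFormula.isModuleHeight {ι : Type*} {d : ι → ℝ} {ν : ι → AbsoluteValue E ℝ}
    (H : ProductFormula d ν) {p : ℕ} [Fact p.Prime] [Module (ZMod p)[X] E] {f : E[X]}
    (hf : 2 ≤ f.natDegree) (hX : ∀ x : E, (X : (ZMod p)[X]) • x = f.eval x) :
    IsModuleHeight (k := ZMod p) (f.natDegree : ℝ) (f.height d ν) := by
  have hf0 : f ≠ 0 := by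
    rintro rfl
    simp at hf
  refine ⟨by exact_mod_cast hf, H.height_nonneg f, height_neg f, H.height_add_le hf0,
    ⟨p, by positivity, fun a x => ?_⟩, ?_⟩
  · have hn : ∀ n : ℕ, f.height d ν (n • x) ≤ n * f.height d ν x := fun n => by
      induction n with
      | zero =>
        have h1 : f.height d ν 0 = 0 := by simp [height]
        simp [h1]
      | succ n ih =>
        rw [succ_nsmul]
        push_cast
        linarith [H.height_add_le hf0 (n • x) x]
    have ha : (C a : (ZMod p)[X]) = (a.val : (ZMod p)[X]) := by
      rw [← map_natCast C, ZMod.natCast_zmod_val]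
    rw [ha, Nat.cast_smul_eq_nsmul]
    refine (hn _).trans (mul_le_mul_of_nonneg_right ?_ (H.height_nonneg f x))
    exact_mod_cast (ZMod.val_lt a).le
  · simp_rw [hX]
    exact H.exists_height_eval_le hf0

/-- Bad reduction at one place makes the module tame: its torsion is finite and saturations of
finitely generated submodules are finitely generated. -/
theorem ProductFormula.finite_torsion_and_fg_saturation {ι : Type*} {d : ι → ℝ}
    {ν : ι → AbsoluteValue E ℝ} (H : ProductFormula d ν) {p : ℕ} [Fact p.Prime]
    [Module (ZMod p)[X] E] {f : E[X]} (hf : 2 ≤ f.natDegree)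
    (hX : ∀ x : E, (X : (ZMod p)[X]) • x = f.eval x)
    (hbad : ∃ i k, f.scaleRadius (ν i) < ν i (f.coeff k) * f.scaleRadius (ν i) ^ k) :
    (Submodule.torsion (ZMod p)[X] E : Set E).Finite ∧
      ∀ N : Submodule (ZMod p)[X] E, N.FG → N.saturation.FG := by
  obtain ⟨ε, hε, hfin⟩ := H.exists_finite_canonicalHeight_le
    (fun x y => by rw [← hX, ← hX, ← hX, smul_add]) hf hbad
  have hpow : ∀ (n : ℕ) (x : E), (X ^ n : (ZMod p)[X]) • x = (fun x => f.eval x)^[n] x :=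
    fun n => by
      induction n with
      | zero => simp
      | succ n ih =>
        intro x
        rw [pow_succ, mul_smul, Function.iterate_succ_apply, ih, hX]
  have hfin' : (canonicalHeightLE (ZMod p) (f.natDegree : ℝ) (f.height d ν) ε).Finite := by
    refine hfin.subset fun x ⟨D, hD⟩ => ⟨D, fun n => ?_⟩
    rw [← hpow]
    exact hD n
  have HM := H.isModuleHeight hf hX
  exact ⟨HM.finite_torsion hε hfin', fun N hN => HM.fg_saturation hε hfin' hN⟩

end Places

namespace DrinfeldModule

open Polynomial

variable {Fq A K : Type*} [Field Fq] [Fintype Fq] [CommRing A] [Field K] [Algebra Fq K]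
  {i : A →+* K}

/-- Twisted polynomials over `K` preserve the `K`-subalgebras of an extension of `K`. -/
theorem evalHom_mem {L : Type*} [Field L] [Algebra Fq L] [Algebra K L] (S : Subalgebra K L)
    (g : TwistedPoly Fq K) {x : L} (hx : x ∈ S) : TwistedPoly.evalHom Fq K L g x ∈ S := by
  obtain ⟨m, hm⟩ := g.exists_coeff_eq_zero
  rw [← TwistedPoly.eval_toPolynomial hm, TwistedPoly.toPolynomial, eval_finsetSum]
  refine sum_mem fun n _ => ?_
  rw [eval_mul, eval_C, eval_pow, eval_X]
  exact mul_mem (S.algebraMap_mem _) (pow_mem hx _)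

/-- If `K` has a discrete valuation, then the points over a perfect purely inseparable extension
`E` of `K` are not finitely generated: finitely many of them lie in `K ^ (1 / p ^ l)` for
some `l`. -/
theorem not_fg_top_points (φ : DrinfeldModule Fq i) (v : DiscreteVal K) (p : ℕ) [Fact p.Prime]
    [CharP K p] {E : Type*} [Field E] [Algebra Fq E] [Algebra K E] [PerfectRing E p]
    (hE : ∀ x : E, ∃ n : ℕ, x ^ p ^ n ∈ (algebraMap K E).range) :
    ¬ (⊤ : Submodule A (φ.Points E)).FG := by
  rintro ⟨s, hs⟩
  have : CharP E p := charP_of_injective_algebraMap (algebraMap K E).injective p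
  choose n hn using hE
  let l := s.sup n
  let S : Subalgebra K E :=
    { carrier := {x | x ^ p ^ l ∈ (algebraMap K E).range}
      mul_mem' := fun {x y} hx hy => by
        rw [Set.mem_ofPred_eq, mul_pow]
        exact mul_mem hx hy
      add_mem' := fun {x y} hx hy => by
        rw [Set.mem_ofPred_eq, add_pow_char_pow]
        exact add_mem hx hy
      algebraMap_mem' := fun r => ⟨r ^ p ^ l, map_pow _ _ _⟩ }
  let N : Submodule A (φ.Points E) :=
    { carrier := (S : Set E)
      zero_mem' := S.zero_mem
      add_mem' := S.add_mem
      smul_mem' := fun a x hx => evalHom_mem S (φ.toRingHom a) hx }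
  have hle : ∀ x : E, n x ≤ l → x ^ p ^ l ∈ (algebraMap K E).range := fun x hx => by
    rw [← Nat.add_sub_cancel' hx, pow_add, pow_mul]
    exact pow_mem (hn x) _
  have hN : (⊤ : Submodule A (φ.Points E)) ≤ N := by
    rw [← hs, Submodule.span_le]
    exact fun x hx => hle x (Finset.le_sup (f := n) hx)
  exact v.not_forall_pow_mem p l fun x =>
    hN (Submodule.mem_top (x := (show φ.Points E from x)))

end DrinfeldModule

/-! ### The points over the perfect closure -/

namespace DrinfeldModule

open Polynomial Submodule

/-- Let `X` act through `t ∈ A` with `φ t` not constant. As an `𝔽_p[X]`-module, the points of `φ`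
over a perfect purely inseparable extension have finite torsion, and saturations of finitely
generated submodules are finitely generated and proper. -/
theorem tame_points {Fq A K : Type*} [Field Fq] [Fintype Fq] [CommRing A] [Field K] [Algebra Fq K]
    {i : A →+* K} (φ : DrinfeldModule Fq i) {U : Set (DiscreteVal K)} {d : U → ℝ}
    (hU : IsGoodSet U d) (hφ : 0 < φ.relModularTrdeg hU.constants) (p : ℕ) [Fact p.Prime]
    [CharP K p] {E : Type*} [Field E] [Algebra Fq E] [Algebra K E] [PerfectRing E p]
    (hE : ∀ x : E, ∃ n : ℕ, x ^ p ^ n ∈ (algebraMap K E).range)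
    [Algebra (ZMod p)[X] A] [Module (ZMod p)[X] (φ.Points E)]
    [IsScalarTower (ZMod p)[X] A (φ.Points E)] {t : A} (htX : algebraMap (ZMod p)[X] A X = t)
    (ht : φ.toRingHom t ≠ TwistedPoly.C Fq (i t)) :
    (torsion (ZMod p)[X] (φ.Points E) : Set (φ.Points E)).Finite ∧
    (∀ N : Submodule (ZMod p)[X] (φ.Points E), N.FG → N.saturation.FG) ∧
    ∀ N : Submodule (ZMod p)[X] (φ.Points E), N.FG → N.saturation ≠ ⊤ := by
  -- the degree `m` of `φ t` is positive
  obtain ⟨m, hm, hlead, hmax⟩ : ∃ m, 0 < m ∧ (φ.toRingHom t).coeff m ≠ 0 ∧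
      ∀ n, m < n → (φ.toRingHom t).coeff n = 0 := by
    obtain ⟨n₀, hn₀, hne⟩ : ∃ n, 0 < n ∧ (φ.toRingHom t).coeff n ≠ 0 := by
      by_contra! h
      refine ht (TwistedPoly.ext fun n => ?_)
      rw [TwistedPoly.coeff_C]
      split_ifs with hn
      · rw [hn, φ.coeff_zero]
      · exact h n (Nat.pos_of_ne_zero hn)
    obtain ⟨b, hb⟩ := (φ.toRingHom t).exists_coeff_eq_zero
    have hle : ∀ n, (φ.toRingHom t).coeff n ≠ 0 → n ≤ b := fun n hn => by
      by_contra! h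
      exact hn (hb n h)
    classical
    let m := Nat.findGreatest (fun n => (φ.toRingHom t).coeff n ≠ 0) b
    refine ⟨m, hn₀.trans_le (Nat.le_findGreatest (hle n₀ hne) hne),
      Nat.findGreatest_spec (P := fun n => (φ.toRingHom t).coeff n ≠ 0) (hle n₀ hne) hne,
      fun n hn => ?_⟩
    by_contra h
    exact absurd (Nat.le_findGreatest (hle n h) h) (not_le.2 hn)
  let f : E[X] := (φ.toRingHom t).toPolynomial E m
  have hlead' : algebraMap K E ((φ.toRingHom t).coeff m) ≠ 0 := by simpa using hlead
  have hdeg : f.natDegree = Fintype.card Fq ^ m := TwistedPoly.natDegree_toPolynomial hmax hlead'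
  have hf : 2 ≤ f.natDegree := hdeg ▸ Nat.one_lt_pow hm.ne' Fintype.one_lt_card
  have hfcoeff : ∀ n, f.coeff (Fintype.card Fq ^ n) = algebraMap K E ((φ.toRingHom t).coeff n) :=
    TwistedPoly.coeff_toPolynomial hmax
  have heval : ∀ x : E, f.eval x = TwistedPoly.evalHom Fq K E (φ.toRingHom t) x :=
    TwistedPoly.eval_toPolynomial hmax
  let : Module (ZMod p)[X] E := inferInstanceAs (Module (ZMod p)[X] (φ.Points E))
  have hX : ∀ x : E, (X : (ZMod p)[X]) • x = f.eval x := fun x => by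
    rw [heval, ← htX]
    exact (algebraMap_smul A (X : (ZMod p)[X]) (show φ.Points E from x)).symm
  obtain ⟨ν, H, hν⟩ := hU.exists_productFormula p hE
  -- a pole of an invariant of `φ` is a place of bad reduction
  obtain ⟨n, hn⟩ := φ.exists_invariant_notMem hU.constants hφ hm hlead hmax
  obtain ⟨v, hv⟩ := hU.exists_one_lt_absValue hn
  have hbad : f.scaleRadius (ν v) < ν v (f.coeff (Fintype.card Fq ^ n)) *
      f.scaleRadius (ν v) ^ Fintype.card Fq ^ n := by
    refine Polynomial.exists_bad_of_one_lt hf (Nat.one_le_pow _ _ Fintype.card_pos) ?_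
    rwa [leadingCoeff, hdeg, hfcoeff, hfcoeff, ← map_pow, ← map_pow, ← map_div₀, hν]
  have h0 : (torsion (ZMod p)[X] (φ.Points E) : Set (φ.Points E)).Finite ∧
      ∀ N : Submodule (ZMod p)[X] (φ.Points E), N.FG → N.saturation.FG :=
    H.finite_torsion_and_fg_saturation hf hX ⟨v, _, hbad⟩
  refine ⟨h0.1, h0.2, fun N hN htop => ?_⟩
  have h1 := h0.2 N hN
  rw [htop] at h1
  exact φ.not_fg_top_points v.1 p hE (FG.of_restrictScalars (ZMod p)[X]
    (by rwa [restrictScalars_top]))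

end DrinfeldModule

end

theorem theoremT
    -- the finite field with `q` elements, a curve over it (through its function field) and `∞`
    {Fq F : Type*} [Field Fq] [Fintype Fq] [Field F] [Algebra Fq F]
    (hF : IsCurveFunctionField Fq F)
    (P : ValuationSubring F) (hP : P ≠ ⊤)
    -- the countable field `K` with a coherent good set of valuations
    {K : Type*} [Field K] [Algebra Fq K] [Countable K]
    (U : Set (DiscreteVal K)) (d : U → ℝ) (hU : IsCoherentGoodSet U d)
    -- the Drinfeld module
    (i : regularAwayFrom P →+* K) (φ : DrinfeldModule Fq i)
    (hφ : 0 < φ.relModularTrdeg hU.isGoodSet.constants) :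
    ∃ T N : Submodule (regularAwayFrom P) (φ.Points (perfectClosure K (AlgebraicClosure K))),
      IsCompl T N ∧
      Finite T ∧ Module.IsTorsion (regularAwayFrom P) T ∧
      Module.Free (regularAwayFrom P) N ∧
      Module.rank (regularAwayFrom P) N = Cardinal.aleph0 := by
  classical
  obtain ⟨t, ht⟩ := φ.exists_ne_const
  obtain ⟨p, hpF⟩ := CharP.exists Fq
  have : Fact p.Prime := ⟨CharP.char_is_prime Fq p⟩
  have : CharP F p := charP_of_injective_algebraMap (algebraMap Fq F).injective p
  have : CharP K p := charP_of_injective_algebraMap (algebraMap Fq K).injective p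
  have : CharP (regularAwayFrom P) p :=
    ((regularAwayFrom P).subtype.charP_iff Subtype.val_injective p).2 inferInstance
  let : Algebra (ZMod p) Fq := ZMod.algebra Fq p
  let : Algebra (ZMod p) F := ZMod.algebra F p
  let : Algebra (ZMod p) (regularAwayFrom P) := ZMod.algebra _ p
  have : IsScalarTower (ZMod p) Fq F := .of_algebraMap_eq' (Subsingleton.elim _ _)
  let g : Polynomial (ZMod p) →+* regularAwayFrom P := (Polynomial.aeval t).toRingHom
  have hg : g Polynomial.X = t := Polynomial.aeval_X t
  let : Algebra (Polynomial (ZMod p)) (regularAwayFrom P) := g.toAlgebra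
  let : Algebra (Polynomial (ZMod p)) F := ((algebraMap (regularAwayFrom P) F).comp g).toAlgebra
  have : IsScalarTower (Polynomial (ZMod p)) (regularAwayFrom P) F := .of_algebraMap_eq' rfl
  have : IsScalarTower (ZMod p) (Polynomial (ZMod p)) F :=
    .of_algebraMap_eq' (Subsingleton.elim _ _)
  let E := perfectClosure K (AlgebraicClosure K)
  let : Module (Polynomial (ZMod p)) (φ.Points E) := Module.compHom _ g
  have : IsScalarTower (Polynomial (ZMod p)) (regularAwayFrom P) (φ.Points E) :=
    ⟨fun r a x => mul_smul (g r) a x⟩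
  have : CharP (AlgebraicClosure K) p :=
    charP_of_injective_algebraMap (algebraMap K (AlgebraicClosure K)).injective p
  have hE : ∀ x : E, ∃ n : ℕ, x ^ p ^ n ∈ (algebraMap K E).range := fun x => by
    obtain ⟨n, y, hy⟩ := (mem_perfectClosure_iff_pow_mem p).1 x.2
    exact ⟨n, y, Subtype.ext hy⟩
  have : PerfectRing E p := inferInstance
  obtain ⟨htors, hfg, htop⟩ := φ.tame_points hU.isGoodSet hφ p (E := E) hE hg ht
  -- a module that is not torsion detects that `t` is transcendental over the prime field
  have hinj : Function.Injective (algebraMap (Polynomial (ZMod p)) (regularAwayFrom P)) := by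
    refine (injective_iff_map_eq_zero _).2 fun r hr => ?_
    by_contra hr0
    refine htop ⊥ Submodule.fg_bot (eq_top_iff.2 fun x _ => Submodule.mem_saturation.2 ⟨r, hr0, ?_⟩)
    rw [← algebraMap_smul (regularAwayFrom P) r x, hr, zero_smul]
    exact zero_mem _
  have : FaithfulSMul (Polynomial (ZMod p)) F := (faithfulSMul_iff_algebraMap_injective _ _).2
    (Subtype.val_injective.comp hinj)
  have : Algebra.IsAlgebraic (Polynomial (ZMod p)) F := hF.isAlgebraic_polynomial
  have : Algebra.IsAlgebraic (Polynomial (ZMod p)) (regularAwayFrom P) :=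
    .tower_bot_of_injective (A := F) Subtype.val_injective
  have hrank : Module.rank (Polynomial (ZMod p)) (regularAwayFrom P) < Cardinal.aleph0 :=
    (LinearMap.rank_le_of_injective
      (IsScalarTower.toAlgHom (Polynomial (ZMod p)) (regularAwayFrom P) F).toLinearMap
      Subtype.val_injective).trans_lt hF.rank_polynomial_lt_aleph0
  have : Countable (φ.Points E) := by
    have h1 := (Algebra.IsAlgebraic.cardinalMk_le_max K (AlgebraicClosure K)).trans
      (max_le (Cardinal.mk_le_aleph0 (α := K)) le_rfl)
    have : Countable (AlgebraicClosure K) := Cardinal.mk_le_aleph0_iff.1 h1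
    exact inferInstanceAs (Countable E)
  exact Submodule.exists_isCompl_finite_free hrank htors hfg htop
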